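/- \textbf{Model.} Let $Q\subseteq\mathbb R^d$, and let $D_1=(x^{(1)}_i)_{i\le n_1}$, $D_2=(x^{(2)}_j)_{j\le n_2}$ be finite designs in $Q$ with $D_2\subseteq D_1$. Let $f_1:Q\to\mathbb R^{p_1}$, $f_2:Q\to\mathbb R^{p_2}$ be regression functions and $r_t(\cdot\,;\theta_t)$, $t=1,2$, correlation functions with fixed $\theta=(\theta_1,\theta_2)$. Given parameters $\beta_1\in\mathbb R^{p_1}$, $\beta_2\in\mathbb R^{p_2}$, $\rho\in\mathbb R$, $\sigma_1^2,\sigma_2^2>0$, let $Z_2(x)=\rho Z_1(x)+\delta(x)$, $x \in Q$, where $Z_1$ and $\delta$ are independent Gaussian processes with means $f_1(x)^T\beta_1$, $f_2(x)^T\beta_2$ and covariances $\sigma_1^2 r_1(x-x';\theta_1)$, $\sigma_2^2r_2(x-x';\theta_2)$. Write $R_t(D,D')$ for the matrix with entries $r_t(x-x';\theta_t)$, $x\in D$, $x'\in D'$, and $R_t(D)=R_t(D,D)$; write $F_t(D)$ for the matrix with rows $f_t(x)^T$, $x\in D$. Let $z_1,z_2:Q\to\mathbb R$ be the two code outputs;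 the data are $z_1(D_1)$ and $z_2(D_2)$. Put $F_1=F_1(D_1)$, $R_1=R_1(D_1)$, $R_2=R_2(D_2)$, $F=[\,z_1(D_2)\ \ F_2(D_2)\,]$ and $\lambda=(\rho,\beta_2)\in\mathbb R^{1+p_2}$. \textbf{Priors.} $IG(\alpha,\gamma)$ has density $\frac{\gamma^\alpha}{\Gamma(\alpha)}\,e^{-\gamma/x}x^{-\alpha-1}\mathbf 1_{x>0}$. For each of the two levels, independently, one of two priors is chosen. (I) Informative: $\beta_1\mid\sigma_1^2\sim N(b_1,\sigma_1^2V_1)$ and $\sigma_1^2\sim IG(\alpha_1,\gamma_1)$, respectively $\lambda\mid z_1,\sigma_2^2\sim N(b_\lambda,\sigma_2^2V_\lambda)$ and $\sigma_2^2\mid z_1\sim IG(\alpha_2,\gamma_2)$, with $V_1,V_\lambda$ diagonal with positive diagonal entries and $\alpha_t,\gamma_t>0$. (II) Non-informative: the density of the regression coefficients given the variance is $\propto1$, and that of the variance is $\propto1/\sigma_t^2$ on $(0,\infty)$. The joint prior is the product $p(\beta_1|\sigma_1^2)\,p(\sigma_1^2)\,p(\lambda|z_1,\sigma_2^2)\,p(\sigma_2^2|z_1)$.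 Posterior densities are given by Bayes' formula (likelihood times prior, normalised to integral one). \textbf{Assumptions.} $R_1$ and $R_2$ are positive definite, $F_1$ and $F$ have full column rank, and, if prior (II) is used at level 1 (respectively level 2), $z_1(D_1)$ is not in the column space of $F_1$ (respectively $z_2(D_2)$ is not in the column space of $F$). \textbf{Claim.} (a) Given the parameters, $Z_1(D_1)$ has density $N(F_1\beta_1,\sigma_1^2R_1)$, and $(Z_1(D_1),Z_2(D_2))$ has density $N\big(H\binom{\beta_1}{\beta_2},V\big)$ with $$H=\begin{pmatrix}F_1(D_1)&0\\ \rho F_1(D_2)&F_2(D_2)\end{pmatrix},\quad V=\begin{pmatrix}\sigma_1^2R_1(D_1)&\rho\sigma_1^2R_1(D_1,D_2)\\ \rho\sigma_1^2R_1(D_2,D_1)&\rho^2\sigma_1^2R_1(D_2)+\sigma_2^2R_2(D_2)\end{pmatrix}.$$ With these likelihoods, the normalising integrals for the posterior of $(\beta_1,\sigma_1^2)$ given $z_1$ and for that of all the parameters given $(z_1,z_2)$ are finite and positive. (b) For all values of the parameters, $$p(\beta_1,\beta_2,\rho,\sigma_1^2,\sigma_2^2|z_1,z_2)=p(\beta_1|\sigma_1^2,z_1)\,p(\beta_2,\rho|\sigma_2^2,z_1,z_2)\,p(\sigma_1^2|z_1)\,p(\sigma_2^2|z_1,z_2),$$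 where the factors given $z_1$ are the conditional and marginal densities of the posterior of $(\beta_1,\sigma_1^2)$ given $z_1$, and those given $(z_1,z_2)$ are the conditional and marginal densities of the full posterior. (c) For all $\sigma_1^2,\sigma_2^2>0$ the factors are the densities of $$\beta_1|\sigma_1^2,z_1\sim N(A^1\nu^1,A^1),\quad(\rho,\beta_2)|\sigma_2^2,z_1,z_2\sim N(A^\lambda\nu^\lambda,A^\lambda),$$ $$\sigma_1^2|z_1\sim IG(a^1,\tfrac12Q^1),\quad\sigma_2^2|z_1,z_2\sim IG(a^2,\tfrac12Q^2).$$ With $\hat\beta_1=(F_1^TR_1^{-1}F_1)^{-1}F_1^TR_1^{-1}z_1(D_1)$ and $S_1=z_1(D_1)^T\big[R_1^{-1}-R_1^{-1}F_1(F_1^TR_1^{-1}F_1)^{-1}F_1^TR_1^{-1}\big]z_1(D_1)$, the level-1 quantities are, in case (I), $$A^1=\Big[F_1^T\tfrac{R_1^{-1}}{\sigma_1^2}F_1+\tfrac{V_1^{-1}}{\sigma_1^2}\Big]^{-1},\quad\nu^1=F_1^T\tfrac{R_1^{-1}}{\sigma_1^2}z_1(D_1)+\tfrac{V_1^{-1}}{\sigma_1^2}b_1,\quad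 a^1=\tfrac{n_1}2+\alpha_1,$$ $$Q^1=2\gamma_1+(b_1-\hat\beta_1)^T\big(V_1+[F_1^TR_1^{-1}F_1]^{-1}\big)^{-1}(b_1-\hat\beta_1)+S_1,$$ and, in case (II), $$A^1=\Big[F_1^T\tfrac{R_1^{-1}}{\sigma_1^2}F_1\Big]^{-1},\quad\nu^1=F_1^T\tfrac{R_1^{-1}}{\sigma_1^2}z_1(D_1),\quad a^1=\tfrac{n_1-p_1}2,\quad Q^1=S_1.$$ The level-2 quantities $A^\lambda,\nu^\lambda,a^2,Q^2$ are given by the same formulas with $(F_1,R_1,z_1(D_1),\sigma_1^2,b_1,V_1,\alpha_1,\gamma_1,n_1,p_1)$ replaced by $(F,R_2,z_2(D_2),\sigma_2^2,b_\lambda,V_\lambda,\alpha_2,\gamma_2,n_2,1+p_2)$. -/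

import Mathlib

open MeasureTheory ProbabilityTheory
open scoped Matrix

noncomputable section

/-! ### Gaussian and inverse-gamma densities -/

/-- Density, with respect to Lebesgue measure on `ι → ℝ`, of the multivariate normal distribution
with mean `m` and (positive definite) covariance matrix `S`. -/
def gaussianDensity {ι : Type*} [Fintype ι] [DecidableEq ι]
    (m : ι → ℝ) (S : Matrix ι ι ℝ) (x : ι → ℝ) : ℝ :=
  (Real.sqrt ((2 * Real.pi) ^ Fintype.card ι * S.det))⁻¹ *
    Real.exp (-((x - m) ⬝ᵥ (S⁻¹ *ᵥ (x - m))) / 2)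

/-- Density of the inverse-gamma distribution `IG(α, Q)`. -/
def invGammaDensity (α Q x : ℝ) : ℝ :=
  if 0 < x then Q ^ α / Real.Gamma α * (Real.exp (-(Q / x)) / x ^ (α + 1)) else 0

/-! ### Priors for one level: regression coefficients `b : κ → ℝ` given the variance `s`, and `s` -/

/-- The prior specification of one level.
* `informative α γ b v`: coefficients given `s` are `N(b, s • diag v)` and `s` is `IG(α, γ)`.
* `jeffreys c c'`: the improper prior with `p(coefficients | s) = c` and `p(s) = c' / s`;
  the positive constants stand for the arbitrary proportionality factors. -/
inductive LevelPrior (κ : Type*) where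
  | informative (α γ : ℝ) (b v : κ → ℝ)
  | jeffreys (c c' : ℝ)

namespace LevelPrior

variable {ι κ : Type*} [Fintype ι] [DecidableEq ι] [Fintype κ] [DecidableEq κ]

/-- The hyper-parameters are in their admissible range. -/
def Valid : LevelPrior κ → Prop
  | informative α γ _ v => 0 < α ∧ 0 < γ ∧ ∀ k, 0 < v k
  | jeffreys c c' => 0 < c ∧ 0 < c'

/-- The prior is the non-informative one. -/
def IsJeffreys : LevelPrior κ → Prop
  | informative _ _ _ _ => False
  | jeffreys _ _ => True

/-- Prior density of the regression coefficients given the variance `s`. -/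
def coefDensity (π : LevelPrior κ) (s : ℝ) (β : κ → ℝ) : ℝ :=
  match π with
  | informative _ _ b v => gaussianDensity b (s • Matrix.diagonal v) β
  | jeffreys c _ => c

/-- Prior density of the variance `s`; it vanishes for `s ≤ 0`. -/
def varDensity (π : LevelPrior κ) (s : ℝ) : ℝ :=
  match π with
  | informative α γ _ _ => invGammaDensity α γ s
  | jeffreys _ c' => if 0 < s then c' / s else 0

/-- Generalised least squares estimator `(Fᵀ R⁻¹ F)⁻¹ Fᵀ R⁻¹ y`. -/
def gls (F : Matrix ι κ ℝ) (R : Matrix ι ι ℝ) (y : ι → ℝ) : κ → ℝ :=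
  (Fᵀ * R⁻¹ * F)⁻¹ *ᵥ ((Fᵀ * R⁻¹) *ᵥ y)

/-- Generalised residual sum of squares `yᵀ (R⁻¹ - R⁻¹ F (Fᵀ R⁻¹ F)⁻¹ Fᵀ R⁻¹) y`. -/
def residual (F : Matrix ι κ ℝ) (R : Matrix ι ι ℝ) (y : ι → ℝ) : ℝ :=
  y ⬝ᵥ ((R⁻¹ - R⁻¹ * F * (Fᵀ * R⁻¹ * F)⁻¹ * Fᵀ * R⁻¹) *ᵥ y)

/-- The matrix `A`: covariance of the coefficients given `s` and the data. -/
def postCov (π : LevelPrior κ) (F : Matrix ι κ ℝ) (R : Matrix ι ι ℝ) (s : ℝ) : Matrix κ κ ℝ :=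
  match π with
  | informative _ _ _ v => (Fᵀ * (s⁻¹ • R⁻¹) * F + s⁻¹ • (Matrix.diagonal v)⁻¹)⁻¹
  | jeffreys _ _ => (Fᵀ * (s⁻¹ • R⁻¹) * F)⁻¹

/-- The vector `ν`; the mean of the coefficients given `s` and the data is `A ν`. -/
def postVec (π : LevelPrior κ) (F : Matrix ι κ ℝ) (R : Matrix ι ι ℝ) (y : ι → ℝ) (s : ℝ) : κ → ℝ :=
  match π with
  | informative _ _ b v => (Fᵀ * (s⁻¹ • R⁻¹)) *ᵥ y + (s⁻¹ • (Matrix.diagonal v)⁻¹) *ᵥ b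
  | jeffreys _ _ => (Fᵀ * (s⁻¹ • R⁻¹)) *ᵥ y

/-- The shape parameter of the posterior of the variance, for `card ι` observations. -/
def postShape (π : LevelPrior κ) (ι : Type*) [Fintype ι] : ℝ :=
  match π with
  | informative α _ _ _ => (Fintype.card ι : ℝ) / 2 + α
  | jeffreys _ _ => ((Fintype.card ι : ℝ) - (Fintype.card κ : ℝ)) / 2

/-- The number `Q`; the scale parameter of the posterior of the variance is `Q / 2`. -/
def postQ (π : LevelPrior κ) (F : Matrix ι κ ℝ) (R : Matrix ι ι ℝ) (y : ι → ℝ) : ℝ :=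
  match π with
  | informative _ γ b v =>
      2 * γ + (b - gls F R y) ⬝ᵥ
        ((Matrix.diagonal v + (Fᵀ * R⁻¹ * F)⁻¹)⁻¹ *ᵥ (b - gls F R y)) + residual F R y
  | jeffreys _ _ => residual F R y

end LevelPrior

/-! ### The two-level autoregressive model -/

/-- Fixed ingredients of the two-level model on an input space `Q ⊆ ℝ^d`: nested designs, regression
functions, and correlation functions `r_t(x - x'; θ_t)`. -/
structure TwoLevelModel (d n₁ n₂ p₁ p₂ : ℕ) (Θ₁ Θ₂ : Type*) where
  Q : Set (EuclideanSpace ℝ (Fin d))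
  D₁ : Fin n₁ → Q
  D₂ : Fin n₂ → Q
  nested : Set.range D₂ ⊆ Set.range D₁
  f₁ : Q → Fin p₁ → ℝ
  f₂ : Q → Fin p₂ → ℝ
  r₁ : EuclideanSpace ℝ (Fin d) → Θ₁ → ℝ
  r₂ : EuclideanSpace ℝ (Fin d) → Θ₂ → ℝ

/-- The vector `(ρ, β₂)`. -/
def lamVec {p : ℕ} (ρ : ℝ) (β₂ : Fin p → ℝ) : Unit ⊕ Fin p → ℝ :=
  Sum.elim (fun _ => ρ) β₂

/-- Under `P` the process `Z` is Gaussian with mean function `m` and covariance function `c`. -/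
structure IsGaussianProcessWith {T Ω : Type*} [MeasurableSpace Ω] (Z : T → Ω → ℝ) (P : Measure Ω)
    (m : T → ℝ) (c : T → T → ℝ) : Prop where
  gaussian : IsGaussianProcess Z P
  mean : ∀ x, ∫ ω, Z x ω ∂P = m x
  covariance : ∀ x y, cov[Z x, Z y; P] = c x y

namespace TwoLevelModel

variable {d n₁ n₂ p₁ p₂ : ℕ} {Θ₁ Θ₂ : Type*} (M : TwoLevelModel d n₁ n₂ p₁ p₂ Θ₁ Θ₂)

/-- `R₁(D, D')` -/
def R₁ (θ₁ : Θ₁) {m k : ℕ} (D : Fin m → M.Q) (D' : Fin k → M.Q) : Matrix (Fin m) (Fin k) ℝ :=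
  Matrix.of fun i j => M.r₁ ((D i : EuclideanSpace ℝ (Fin d)) - D' j) θ₁

/-- `R₂(D, D')` -/
def R₂ (θ₂ : Θ₂) {m k : ℕ} (D : Fin m → M.Q) (D' : Fin k → M.Q) : Matrix (Fin m) (Fin k) ℝ :=
  Matrix.of fun i j => M.r₂ ((D i : EuclideanSpace ℝ (Fin d)) - D' j) θ₂

/-- `F₁(D)`, with rows `f₁(x)ᵀ` -/
def F₁ {m : ℕ} (D : Fin m → M.Q) : Matrix (Fin m) (Fin p₁) ℝ := Matrix.of fun i => M.f₁ (D i)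

/-- `F₂(D)`, with rows `f₂(x)ᵀ` -/
def F₂ {m : ℕ} (D : Fin m → M.Q) : Matrix (Fin m) (Fin p₂) ℝ := Matrix.of fun i => M.f₂ (D i)

/-- The design matrix `F = [z₁(D₂)  F₂(D₂)]` of the second level. -/
def F (z₁ : M.Q → ℝ) : Matrix (Fin n₂) (Unit ⊕ Fin p₂) ℝ :=
  Matrix.of fun j => lamVec (z₁ (M.D₂ j)) (M.f₂ (M.D₂ j))

/-- The matrix `H` (it depends on `ρ`). -/
def H (ρ : ℝ) : Matrix (Fin n₁ ⊕ Fin n₂) (Fin p₁ ⊕ Fin p₂) ℝ :=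
  Matrix.fromBlocks (M.F₁ M.D₁) 0 (ρ • M.F₁ M.D₂) (M.F₂ M.D₂)

/-- The covariance matrix `V` of the observations, where `s_t` stands for `σ_t²`. -/
def V (θ₁ : Θ₁) (θ₂ : Θ₂) (ρ s₁ s₂ : ℝ) : Matrix (Fin n₁ ⊕ Fin n₂) (Fin n₁ ⊕ Fin n₂) ℝ :=
  Matrix.fromBlocks (s₁ • M.R₁ θ₁ M.D₁ M.D₁) ((ρ * s₁) • M.R₁ θ₁ M.D₁ M.D₂)
    ((ρ * s₁) • M.R₁ θ₁ M.D₂ M.D₁)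
    ((ρ ^ 2 * s₁) • M.R₁ θ₁ M.D₂ M.D₂ + s₂ • M.R₂ θ₂ M.D₂ M.D₂)

/-- The autoregressive model given the parameters: under `P`, `Z₁` and `δ` are independent Gaussian
processes with the prescribed means and covariances, and `Z₂ = ρ Z₁ + δ`. -/
structure IsAutoregressive (θ₁ : Θ₁) (θ₂ : Θ₂) (β₁ : Fin p₁ → ℝ) (β₂ : Fin p₂ → ℝ) (ρ s₁ s₂ : ℝ)
    {Ω : Type*} [MeasurableSpace Ω] (P : Measure Ω) (Z₁ Z₂ δ : M.Q → Ω → ℝ) : Prop where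
  level₁ : IsGaussianProcessWith Z₁ P (fun x => M.f₁ x ⬝ᵥ β₁)
    (fun x y => s₁ * M.r₁ ((x : EuclideanSpace ℝ (Fin d)) - y) θ₁)
  discrepancy : IsGaussianProcessWith δ P (fun x => M.f₂ x ⬝ᵥ β₂)
    (fun x y => s₂ * M.r₂ ((x : EuclideanSpace ℝ (Fin d)) - y) θ₂)
  indep : IndepFun (fun ω x => Z₁ x ω) (fun ω x => δ x ω) P
  autoregression : ∀ x ω, Z₂ x ω = ρ * Z₁ x ω + δ x ω

/-- The likelihood `p(y₁ | β₁, σ₁², θ₁)` of the first-level observations. -/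
def likelihood₁ (θ₁ : Θ₁) (β₁ : Fin p₁ → ℝ) (s₁ : ℝ) (y₁ : Fin n₁ → ℝ) : ℝ :=
  gaussianDensity (M.F₁ M.D₁ *ᵥ β₁) (s₁ • M.R₁ θ₁ M.D₁ M.D₁) y₁

/-- The likelihood `p(y₁, y₂ | β₁, β₂, ρ, σ₁², σ₂², θ)` of all the observations: the density of
`N(H β, V)`. -/
def likelihood (θ₁ : Θ₁) (θ₂ : Θ₂) (β₁ : Fin p₁ → ℝ) (β₂ : Fin p₂ → ℝ) (ρ s₁ s₂ : ℝ)
    (y : Fin n₁ ⊕ Fin n₂ → ℝ) : ℝ :=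
  gaussianDensity (M.H ρ *ᵥ Sum.elim β₁ β₂) (M.V θ₁ θ₂ ρ s₁ s₂) y

/-- The code outputs at the design points. -/
def obs (z₁ z₂ : M.Q → ℝ) : Fin n₁ ⊕ Fin n₂ → ℝ := Sum.elim (z₁ ∘ M.D₁) (z₂ ∘ M.D₂)

/-! #### First level: posterior of `(β₁, σ₁²)` given `z₁` -/

section Level₁

variable (θ₁ : Θ₁) (π₁ : LevelPrior (Fin p₁)) (z₁ : M.Q → ℝ)

/-- likelihood times prior -/
def joint₁ (q : (Fin p₁ → ℝ) × ℝ) : ℝ :=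
  M.likelihood₁ θ₁ q.1 q.2 (z₁ ∘ M.D₁) * (π₁.coefDensity q.2 q.1 * π₁.varDensity q.2)

/-- `p(β₁, σ₁² | z₁)`, by Bayes' formula -/
def post₁ (β₁ : Fin p₁ → ℝ) (s₁ : ℝ) : ℝ := M.joint₁ θ₁ π₁ z₁ (β₁, s₁) / ∫ q, M.joint₁ θ₁ π₁ z₁ q

/-- `p(σ₁² | z₁)` -/
def postVar₁ (s₁ : ℝ) : ℝ := ∫ β₁, M.post₁ θ₁ π₁ z₁ β₁ s₁

/-- `p(β₁ | σ₁², z₁)` -/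
def postCoef₁ (s₁ : ℝ) (β₁ : Fin p₁ → ℝ) : ℝ := M.post₁ θ₁ π₁ z₁ β₁ s₁ / M.postVar₁ θ₁ π₁ z₁ s₁

end Level₁

/-! #### Posterior of all the parameters given `z₁` and `z₂`

The parameters are ordered as `(β₁, (ρ, β₂), σ₁², σ₂²)`. -/

section Full

variable (θ₁ : Θ₁) (θ₂ : Θ₂) (π₁ : LevelPrior (Fin p₁)) (π₂ : LevelPrior (Unit ⊕ Fin p₂))
  (z₁ z₂ : M.Q → ℝ)

/-- likelihood times hierarchical prior `p(β₁|σ₁²) p(σ₁²) p(ρ,β₂|z₁,σ₂²) p(σ₂²|z₁)` -/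
def joint (q : (Fin p₁ → ℝ) × (Unit ⊕ Fin p₂ → ℝ) × ℝ × ℝ) : ℝ :=
  M.likelihood θ₁ θ₂ q.1 (q.2.1 ∘ Sum.inr) (q.2.1 (Sum.inl ())) q.2.2.1 q.2.2.2 (M.obs z₁ z₂) *
    ((π₁.coefDensity q.2.2.1 q.1 * π₁.varDensity q.2.2.1) *
      (π₂.coefDensity q.2.2.2 q.2.1 * π₂.varDensity q.2.2.2))

/-- `p(β₁, ρ, β₂, σ₁², σ₂² | z₁, z₂)`, by Bayes' formula -/
def post (β₁ : Fin p₁ → ℝ) (lam : Unit ⊕ Fin p₂ → ℝ) (s₁ s₂ : ℝ) : ℝ :=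
  M.joint θ₁ θ₂ π₁ π₂ z₁ z₂ (β₁, lam, s₁, s₂) / ∫ q, M.joint θ₁ θ₂ π₁ π₂ z₁ z₂ q

/-- `p(ρ, β₂, σ₂² | z₁, z₂)`, a marginal of the full posterior -/
def post₂ (lam : Unit ⊕ Fin p₂ → ℝ) (s₂ : ℝ) : ℝ :=
  ∫ q : (Fin p₁ → ℝ) × ℝ, M.post θ₁ θ₂ π₁ π₂ z₁ z₂ q.1 lam q.2 s₂

/-- `p(σ₂² | z₁, z₂)` -/
def postVar₂ (s₂ : ℝ) : ℝ := ∫ lam, M.post₂ θ₁ θ₂ π₁ π₂ z₁ z₂ lam s₂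

/-- `p(ρ, β₂ | σ₂², z₁, z₂)` -/
def postCoef₂ (s₂ : ℝ) (lam : Unit ⊕ Fin p₂ → ℝ) : ℝ :=
  M.post₂ θ₁ θ₂ π₁ π₂ z₁ z₂ lam s₂ / M.postVar₂ θ₁ θ₂ π₁ π₂ z₁ z₂ s₂

end Full

end TwoLevelModel

end

/-!
At each level, likelihood times prior is, as a function of the coefficients `β` and the variance
`s > 0`, a multiple of `s ^ (-e) * exp (-E(β) / s)` with `E` quadratic. Completing the square in `E`
identifies it with a multiple of a normal-inverse-gamma density.

Because the designs are nested, the observations are the image of the independent Gaussian vectors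
`Z₁(D₁)` and `δ(D₂)` under a matrix of determinant one. Changing variables, the full likelihood at
`(z₁(D₁), z₂(D₂))` is the likelihood of level 1 times that of a regression of `z₂(D₂)` on
`[z₁(D₂)  F₂(D₂)]` with coefficients `(ρ, β₂)`. So the two levels decouple, and the posterior is a
product of two normal-inverse-gamma densities.
-/

noncomputable section

section NormalizesTo

variable {α β γ δ : Type*} [MeasurableSpace α] [MeasurableSpace β] [MeasurableSpace γ]
  [MeasurableSpace δ] {μ : Measure α} {ν : Measure β}

/-- `f` is obtained from `g` by normalising its `μ`-integral to one, as in Bayes' formula. -/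
structure NormalizesTo (μ : Measure α) (g f : α → ℝ) : Prop where
  exists_eq_const_mul : ∃ C, 0 < C ∧ ∀ x, g x = C * f x
  integrable : Integrable f μ
  integral_eq_one : ∫ x, f x ∂μ = 1

namespace NormalizesTo

variable {g f : α → ℝ} {g' f' : β → ℝ}

lemma integrable_left (h : NormalizesTo μ g f) : Integrable g μ := by
  obtain ⟨C, -, hg⟩ := h.exists_eq_const_mul
  exact (h.integrable.const_mul C).congr (.of_forall fun x => (hg x).symm)

lemma integral_left_pos (h : NormalizesTo μ g f) : 0 < ∫ x, g x ∂μ := by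
  obtain ⟨C, hC, hg⟩ := h.exists_eq_const_mul
  simpa only [hg, integral_const_mul, h.integral_eq_one, mul_one] using hC

lemma div_integral_eq (h : NormalizesTo μ g f) (x : α) : g x / ∫ y, g y ∂μ = f x := by
  obtain ⟨C, hC, hg⟩ := h.exists_eq_const_mul
  simp only [hg, integral_const_mul, h.integral_eq_one, mul_one]
  exact mul_div_cancel_left₀ (f x) hC.ne'

lemma mul_prod [SFinite μ] [SFinite ν] (h : NormalizesTo μ g f) (h' : NormalizesTo ν g' f') :
    NormalizesTo (μ.prod ν) (fun p => g p.1 * g' p.2) (fun p => f p.1 * f' p.2) := by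
  obtain ⟨C, hC, hg⟩ := h.exists_eq_const_mul
  obtain ⟨C', hC', hg'⟩ := h'.exists_eq_const_mul
  refine ⟨⟨C * C', mul_pos hC hC', fun p => ?_⟩, h.integrable.mul_prod h'.integrable, ?_⟩
  · rw [hg, hg', mul_mul_mul_comm]
  · rw [integral_prod_mul, h.integral_eq_one, h'.integral_eq_one, one_mul]

lemma comp_measurePreserving (h : NormalizesTo μ g f) {φ : β → α}
    (hφ : MeasurePreserving φ ν μ) : NormalizesTo ν (g ∘ φ) (f ∘ φ) := by
  obtain ⟨C, hC, hg⟩ := h.exists_eq_const_mul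
  refine ⟨⟨C, hC, fun x => hg (φ x)⟩, hφ.integrable_comp_of_integrable h.integrable, ?_⟩
  rw [← h.integral_eq_one, ← hφ.map_eq]
  exact (integral_map hφ.aemeasurable (hφ.map_eq.symm ▸ h.integrable.aestronglyMeasurable)).symm

end NormalizesTo

lemma measurePreserving_prod_prod_prod_comm (μ : Measure α) (ν : Measure β) (ξ : Measure γ)
    (ζ : Measure δ) [SigmaFinite μ] [SigmaFinite ν] [SigmaFinite ξ] [SigmaFinite ζ] :
    MeasurePreserving (fun q : α × β × γ × δ => ((q.1, q.2.2.1), (q.2.1, q.2.2.2)))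
      (μ.prod (ν.prod (ξ.prod ζ))) ((μ.prod ξ).prod (ν.prod ζ)) := by
  have hswap : MeasurePreserving (fun q : β × γ × δ => (q.2.1, (q.1, q.2.2)))
      (ν.prod (ξ.prod ζ)) (ξ.prod (ν.prod ζ)) :=
    (measurePreserving_prodAssoc ξ ν ζ).comp
      ((Measure.measurePreserving_swap.prod (.id ζ)).comp
        ((measurePreserving_prodAssoc ν ξ ζ).symm _))
  exact ((measurePreserving_prodAssoc μ ξ (ν.prod ζ)).symm _).comp
    ((MeasurePreserving.id μ).prod hswap)

end NormalizesTo

section InverseGamma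

/-- The unnormalised inverse-gamma density with exponent `e` and energy `E`. Likelihoods and prior
densities, seen as functions of the variance, are multiples of it. Only `0 < s` is meaningful. -/
def varianceKernel (e E s : ℝ) : ℝ := s ^ (-e) * Real.exp (-(E / s))

lemma varianceKernel_mul_varianceKernel (e e' E E' : ℝ) {s : ℝ} (hs : 0 < s) :
    varianceKernel e E s * varianceKernel e' E' s = varianceKernel (e + e') (E + E') s := by
  rw [varianceKernel, varianceKernel, varianceKernel, mul_mul_mul_comm, ← Real.rpow_add hs,
    ← Real.exp_add, neg_add, add_div, neg_add]

lemma varianceKernel_eq_comp_rpow_neg_one (a E : ℝ) {s : ℝ} (hs : 0 < s) :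
    varianceKernel (a + 1) E s = (|(-1 : ℝ)| * s ^ ((-1 : ℝ) - 1)) •
      ((s ^ (-1 : ℝ)) ^ (a - 1) * Real.exp (-(E * s ^ (-1 : ℝ)))) := by
  rw [varianceKernel, smul_eq_mul, abs_neg, abs_one, one_mul, ← mul_assoc, ← Real.rpow_mul hs.le,
    ← Real.rpow_add hs, Real.rpow_neg_one, div_eq_mul_inv]
  ring_nf

lemma integrableOn_varianceKernel {a E : ℝ} (ha : 0 < a) (hE : 0 < E) :
    IntegrableOn (varianceKernel (a + 1) E) (Set.Ioi 0) := by
  refine IntegrableOn.congr_fun ?_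
    (fun s hs => (varianceKernel_eq_comp_rpow_neg_one a E (Set.mem_Ioi.1 hs)).symm)
    measurableSet_Ioi
  refine (integrableOn_Ioi_comp_rpow_iff (fun t : ℝ => t ^ (a - 1) * Real.exp (-(E * t)))
    (by norm_num : (-1 : ℝ) ≠ 0)).2 ?_
  simpa only [Real.rpow_one, neg_mul] using
    integrableOn_rpow_mul_exp_neg_mul_rpow (s := a - 1) (by linarith) one_pos hE

lemma integral_varianceKernel {a E : ℝ} (ha : 0 < a) (hE : 0 < E) :
    ∫ s in Set.Ioi 0, varianceKernel (a + 1) E s = (1 / E) ^ a * Real.Gamma a := by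
  rw [setIntegral_congr_fun measurableSet_Ioi
      (fun s hs => varianceKernel_eq_comp_rpow_neg_one a E (Set.mem_Ioi.1 hs)),
    integral_comp_rpow_Ioi (fun t : ℝ => t ^ (a - 1) * Real.exp (-(E * t)))
      (by norm_num : (-1 : ℝ) ≠ 0), Real.integral_rpow_mul_exp_neg_mul_Ioi ha hE]

lemma invGammaDensity_of_pos (a Q : ℝ) {s : ℝ} (hs : 0 < s) :
    invGammaDensity a Q s = Q ^ a / Real.Gamma a * varianceKernel (a + 1) Q s := by
  rw [invGammaDensity, if_pos hs, varianceKernel, Real.rpow_neg hs.le,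
    div_eq_inv_mul (Real.exp _)]

lemma invGammaDensity_of_nonpos (a Q : ℝ) {s : ℝ} (hs : s ≤ 0) : invGammaDensity a Q s = 0 :=
  if_neg hs.not_gt

lemma invGammaDensity_eq_indicator (a Q : ℝ) :
    invGammaDensity a Q =
      (Set.Ioi 0).indicator fun s => Q ^ a / Real.Gamma a * varianceKernel (a + 1) Q s := by
  ext s
  rcases le_or_gt s 0 with hs | hs
  · rw [Set.indicator_of_notMem (Set.notMem_Ioi.2 hs), invGammaDensity_of_nonpos a Q hs]
  · rw [Set.indicator_of_mem (Set.mem_Ioi.2 hs), invGammaDensity_of_pos a Q hs]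

lemma exists_invGammaDensity_eq_varianceKernel {a Q : ℝ} (ha : 0 < a) (hQ : 0 < Q) :
    ∃ C, 0 < C ∧ ∀ s, 0 < s → invGammaDensity a Q s = C * varianceKernel (a + 1) Q s :=
  ⟨Q ^ a / Real.Gamma a, div_pos (Real.rpow_pos_of_pos hQ a) (Real.Gamma_pos_of_pos ha),
    fun _ hs => invGammaDensity_of_pos a Q hs⟩

lemma invGammaDensity_pos {a Q s : ℝ} (ha : 0 < a) (hQ : 0 < Q) (hs : 0 < s) :
    0 < invGammaDensity a Q s := by
  have := Real.Gamma_pos_of_pos ha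
  rw [invGammaDensity, if_pos hs]
  positivity

lemma invGammaDensity_nonneg {a Q : ℝ} (ha : 0 < a) (hQ : 0 < Q) (s : ℝ) :
    0 ≤ invGammaDensity a Q s := by
  rcases le_or_gt s 0 with hs | hs
  · exact (invGammaDensity_of_nonpos a Q hs).ge
  · exact (invGammaDensity_pos ha hQ hs).le

lemma measurable_invGammaDensity (a Q : ℝ) : Measurable (invGammaDensity a Q) :=
  Measurable.ite measurableSet_Ioi (by fun_prop) measurable_const

lemma integrable_invGammaDensity {a Q : ℝ} (ha : 0 < a) (hQ : 0 < Q) :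
    Integrable (invGammaDensity a Q) := by
  rw [invGammaDensity_eq_indicator, integrable_indicator_iff measurableSet_Ioi]
  exact (integrableOn_varianceKernel ha hQ).const_mul _

lemma integral_invGammaDensity {a Q : ℝ} (ha : 0 < a) (hQ : 0 < Q) :
    ∫ s, invGammaDensity a Q s = 1 := by
  have hΓ := (Real.Gamma_pos_of_pos ha).ne'
  have hQa := (Real.rpow_pos_of_pos hQ a).ne'
  rw [invGammaDensity_eq_indicator, integral_indicator measurableSet_Ioi, integral_const_mul,
    integral_varianceKernel ha hQ, one_div, Real.inv_rpow hQ.le]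
  field_simp

end InverseGamma

section QuadraticForm

variable {ι κ α : Type*} [Fintype ι] [Fintype κ] [CommRing α]

lemma dotProduct_mulVec_comm_of_isSymm {M : Matrix κ κ α} (hM : M.IsSymm) (x y : κ → α) :
    x ⬝ᵥ (M *ᵥ y) = y ⬝ᵥ (M *ᵥ x) := by
  rw [dotProduct_comm, ← Matrix.vecMul_transpose, hM.eq, ← Matrix.dotProduct_mulVec]

lemma mulVec_dotProduct (F : Matrix ι κ α) (β : κ → α) (x : ι → α) :
    (F *ᵥ β) ⬝ᵥ x = β ⬝ᵥ (Fᵀ *ᵥ x) := by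
  rw [Matrix.dotProduct_mulVec, Matrix.vecMul_transpose]

lemma sub_dotProduct_mulVec_sub {M : Matrix κ κ α} (hM : M.IsSymm) (x y : κ → α) :
    (x - y) ⬝ᵥ (M *ᵥ (x - y)) = x ⬝ᵥ (M *ᵥ x) - 2 * (x ⬝ᵥ (M *ᵥ y)) + y ⬝ᵥ (M *ᵥ y) := by
  rw [Matrix.mulVec_sub, sub_dotProduct, dotProduct_sub, dotProduct_sub,
    dotProduct_mulVec_comm_of_isSymm hM y x]
  ring

lemma dotProduct_mulVec_sub_two_mul [DecidableEq κ] {M : Matrix κ κ α} (hM : M.IsSymm)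
    (hu : IsUnit M) (x c : κ → α) :
    x ⬝ᵥ (M *ᵥ x) - 2 * (x ⬝ᵥ c) =
      (x - M⁻¹ *ᵥ c) ⬝ᵥ (M *ᵥ (x - M⁻¹ *ᵥ c)) - c ⬝ᵥ (M⁻¹ *ᵥ c) := by
  rw [sub_dotProduct_mulVec_sub hM, Matrix.mulVec_mulVec,
    Matrix.mul_nonsing_inv _ ((Matrix.isUnit_iff_isUnit_det M).1 hu), Matrix.one_mulVec,
    dotProduct_comm (M⁻¹ *ᵥ c)]
  ring

lemma matrix_inv_add_inv_inv [DecidableEq κ] {G D : Matrix κ κ α} (hG : IsUnit G) (hD : IsUnit D)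
    (hGD : IsUnit (G + D)) : (D⁻¹ + G⁻¹)⁻¹ = D - D * (G + D)⁻¹ * D := by
  have hDinv : D⁻¹⁻¹ = D := Matrix.nonsing_inv_nonsing_inv D ((Matrix.isUnit_iff_isUnit_det D).1 hD)
  have hGinv : G⁻¹⁻¹ = G := Matrix.nonsing_inv_nonsing_inv G ((Matrix.isUnit_iff_isUnit_det G).1 hG)
  have h := Matrix.add_mul_mul_inv_eq_sub D⁻¹ 1 G⁻¹ 1 (Matrix.isUnit_nonsing_inv_iff.2 hD)
    (Matrix.isUnit_nonsing_inv_iff.2 hG) (by simpa [hDinv, hGinv] using hGD)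
  simpa [hDinv, hGinv] using h

lemma dotProduct_mulVec_sub_add_sub [DecidableEq κ] {G D : Matrix κ κ α} (hG : IsUnit G)
    (hGs : G.IsSymm) (hD : IsUnit D) (hDs : D.IsSymm) (hGD : IsUnit (G + D)) (β g b : κ → α) :
    (β - g) ⬝ᵥ (G *ᵥ (β - g)) + (β - b) ⬝ᵥ (D *ᵥ (β - b)) =
      (β - (G + D)⁻¹ *ᵥ (G *ᵥ g + D *ᵥ b)) ⬝ᵥ
          ((G + D) *ᵥ (β - (G + D)⁻¹ *ᵥ (G *ᵥ g + D *ᵥ b))) +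
        (b - g) ⬝ᵥ ((D⁻¹ + G⁻¹)⁻¹ *ᵥ (b - g)) := by
  have hmean : (G + D)⁻¹ *ᵥ (G *ᵥ g + D *ᵥ b) = g + (G + D)⁻¹ *ᵥ (D *ᵥ (b - g)) := by
    rw [show G *ᵥ g + D *ᵥ b = (G + D) *ᵥ g + D *ᵥ (b - g) by
      rw [Matrix.add_mulVec, Matrix.mulVec_sub]; abel, Matrix.mulVec_add,
      Matrix.mulVec_mulVec _ _ (G + D),
      Matrix.nonsing_inv_mul _ ((Matrix.isUnit_iff_isUnit_det _).1 hGD), Matrix.one_mulVec]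
  have hsquare := dotProduct_mulVec_sub_two_mul (hGs.add hDs) hGD (β - g) (D *ᵥ (b - g))
  have hcross : (D *ᵥ (b - g)) ⬝ᵥ ((G + D)⁻¹ *ᵥ (D *ᵥ (b - g))) =
      (b - g) ⬝ᵥ ((D * (G + D)⁻¹ * D) *ᵥ (b - g)) := by
    rw [mulVec_dotProduct, hDs.eq, Matrix.mulVec_mulVec, Matrix.mulVec_mulVec]
  rw [Matrix.add_mulVec G D (β - g), dotProduct_add, hcross] at hsquare
  rw [hmean, ← sub_sub, matrix_inv_add_inv_inv hG hD hGD, show β - b = (β - g) - (b - g) by abel,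
    sub_dotProduct_mulVec_sub hDs, Matrix.sub_mulVec, dotProduct_sub]
  linear_combination hsquare

end QuadraticForm

section GaussianDensity

variable {ι κ : Type*} [Fintype ι] [DecidableEq ι] [Fintype κ] [DecidableEq κ]

lemma gaussianDensity_nonneg (m : ι → ℝ) (S : Matrix ι ι ℝ) (x : ι → ℝ) :
    0 ≤ gaussianDensity m S x :=
  mul_nonneg (inv_nonneg.2 (Real.sqrt_nonneg _)) (Real.exp_pos _).le

lemma continuous_gaussianDensity (m : ι → ℝ) (S : Matrix ι ι ℝ) :
    Continuous (gaussianDensity m S) := by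
  unfold gaussianDensity
  fun_prop

lemma measurable_ofReal_gaussianDensity (m : ι → ℝ) (S : Matrix ι ι ℝ) :
    Measurable fun x => ENNReal.ofReal (gaussianDensity m S x) :=
  (continuous_gaussianDensity m S).measurable.ennreal_ofReal

lemma gaussianDensity_affine {B : Matrix ι ι ℝ} (hB : B.det ≠ 0) (S : Matrix ι ι ℝ)
    (a m x : ι → ℝ) :
    gaussianDensity (a + B *ᵥ m) (B * S * Bᵀ) (a + B *ᵥ x) =
      |B.det|⁻¹ * gaussianDensity m S x := by
  have hquad : (B *ᵥ (x - m)) ⬝ᵥ ((B * S * Bᵀ)⁻¹ *ᵥ (B *ᵥ (x - m))) =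
      (x - m) ⬝ᵥ (S⁻¹ *ᵥ (x - m)) := by
    rw [mulVec_dotProduct, Matrix.mul_inv_rev, Matrix.mul_inv_rev, Matrix.mulVec_mulVec,
      Matrix.mulVec_mulVec, Matrix.mul_assoc, Matrix.mul_assoc,
      Matrix.nonsing_inv_mul_cancel_right _ _ hB.isUnit,
      Matrix.mul_nonsing_inv_cancel_left _ _ (B.isUnit_det_transpose hB.isUnit)]
  have hdet : (2 * Real.pi) ^ Fintype.card ι * (B.det * S.det * B.det) =
      B.det ^ 2 * ((2 * Real.pi) ^ Fintype.card ι * S.det) := by ring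
  rw [gaussianDensity, gaussianDensity, add_sub_add_left_eq_sub, ← Matrix.mulVec_sub, hquad,
    Matrix.det_mul, Matrix.det_mul, Matrix.det_transpose, hdet, Real.sqrt_mul (sq_nonneg _),
    Real.sqrt_sq_eq_abs, mul_inv, mul_assoc]

lemma matrix_inv_smul_of_ne_zero {α : Type*} [Field α] {s : α} (hs : s ≠ 0) {S : Matrix ι ι α}
    (hS : S.det ≠ 0) : (s • S)⁻¹ = s⁻¹ • S⁻¹ :=
  Matrix.inv_smul' S (Units.mk0 s hs) hS.isUnit

lemma exists_gaussianDensity_smul_eq_varianceKernel {S : Matrix ι ι ℝ} (hS : 0 < S.det) :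
    ∃ C, 0 < C ∧ ∀ (m x : ι → ℝ) (s : ℝ), 0 < s → gaussianDensity m (s • S) x =
      C * varianceKernel (Fintype.card ι / 2) ((x - m) ⬝ᵥ (S⁻¹ *ᵥ (x - m)) / 2) s := by
  refine ⟨(Real.sqrt ((2 * Real.pi) ^ Fintype.card ι * S.det))⁻¹, by positivity,
    fun m x s hs => ?_⟩
  have hsqrt : Real.sqrt (s ^ Fintype.card ι) = s ^ ((Fintype.card ι : ℝ) / 2) := by
    rw [Real.sqrt_eq_rpow, ← Real.rpow_natCast_mul hs.le, mul_one_div]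
  rw [gaussianDensity, varianceKernel, matrix_inv_smul_of_ne_zero hs.ne' hS.ne', Matrix.smul_mulVec,
    dotProduct_smul, Matrix.det_smul, mul_left_comm, Real.sqrt_mul (by positivity), hsqrt,
    Real.rpow_neg hs.le, smul_eq_mul, mul_inv]
  ring_nf

lemma gaussianDensity_fromBlocks {A : Matrix ι ι ℝ} {D : Matrix κ κ ℝ} (hA : 0 < A.det)
    (hD : 0 < D.det) (m x : ι → ℝ) (n y : κ → ℝ) :
    gaussianDensity (Sum.elim m n) (Matrix.fromBlocks A 0 0 D) (Sum.elim x y) =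
      gaussianDensity m A x * gaussianDensity n D y := by
  have hinv : (Matrix.fromBlocks A 0 0 D)⁻¹ = Matrix.fromBlocks A⁻¹ 0 0 D⁻¹ := by
    simp [Matrix.inv_fromBlocks_zero₂₁_of_isUnit_iff, Matrix.isUnit_iff_isUnit_det, hA.ne', hD.ne']
  have hsub : Sum.elim x y - Sum.elim m n = Sum.elim (x - m) (y - n) := by
    ext (i | i) <;> rfl
  have hdet : (2 * Real.pi) ^ (Fintype.card ι + Fintype.card κ) * (A.det * D.det) =
      ((2 * Real.pi) ^ Fintype.card ι * A.det) * ((2 * Real.pi) ^ Fintype.card κ * D.det) := by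
    ring
  simp only [gaussianDensity, hinv, hsub, Matrix.fromBlocks_mulVec, Sum.elim_comp_inl,
    Sum.elim_comp_inr, Matrix.zero_mulVec, add_zero, zero_add, sumElim_dotProduct_sumElim,
    Matrix.det_fromBlocks_zero₂₁, Fintype.card_sum]
  rw [hdet, Real.sqrt_mul (by positivity), mul_inv, neg_add, add_div, Real.exp_add,
    mul_mul_mul_comm]

lemma gaussianDensity_one (m x : ι → ℝ) :
    gaussianDensity m 1 x = ∏ i, gaussianPDFReal (m i) 1 (x i) := by
  have hconst : Real.sqrt ((2 * Real.pi) ^ Fintype.card ι) =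
      Real.sqrt (2 * Real.pi) ^ Fintype.card ι := by
    rw [Real.sqrt_eq_iff_mul_self_eq (by positivity) (by positivity), ← mul_pow,
      Real.mul_self_sqrt (by positivity)]
  have hexponent : -((x - m) ⬝ᵥ (x - m)) / 2 = ∑ i, -(x i - m i) ^ 2 / 2 := by
    simp only [dotProduct, Pi.sub_apply, sq, ← Finset.sum_neg_distrib, Finset.sum_div]
  simp only [gaussianPDFReal, Finset.prod_mul_distrib, ← Real.exp_sum, Finset.prod_const,
    gaussianDensity, Finset.card_univ, Matrix.det_one, inv_one, Matrix.one_mulVec,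
    mul_one, NNReal.coe_one, hconst, hexponent, inv_pow]

end GaussianDensity

section DensityTransformations

lemma map_withDensity_comp {α β : Type*} [MeasurableSpace α] [MeasurableSpace β] {μ : Measure α}
    {ν : Measure β} {φ : α → β} (hφ : MeasurePreserving φ μ ν) {f : β → ENNReal}
    (hf : Measurable f) : (μ.withDensity (f ∘ φ)).map φ = ν.withDensity f := by
  ext s hs
  rw [Measure.map_apply hφ.measurable hs, withDensity_apply _ (hφ.measurable hs),
    withDensity_apply _ hs]
  exact hφ.setLIntegral_comp_preimage hs hf

lemma measurePreserving_affine {ι : Type*} [Fintype ι] [DecidableEq ι] (a : ι → ℝ)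
    {B : Matrix ι ι ℝ} (hB : B.det ≠ 0) :
    MeasurePreserving (fun x => a + B *ᵥ x) volume (ENNReal.ofReal |B.det⁻¹| • volume) := by
  have hlin : MeasurePreserving (B *ᵥ ·) volume (ENNReal.ofReal |B.det⁻¹| • volume) :=
    ⟨by fun_prop, Real.map_matrix_volume_pi_eq_smul_volume_pi hB⟩
  exact ((measurePreserving_add_left volume a).smul_measure _).comp hlin

lemma pi_withDensity_ofReal {ι : Type*} [Fintype ι] {α : ι → Type*} [∀ i, MeasurableSpace (α i)]
    {μ : ∀ i, Measure (α i)} [∀ i, SigmaFinite (μ i)] {f : ∀ i, α i → ℝ} (hf : ∀ i, 0 ≤ f i)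
    (hint : ∀ i, Integrable (f i) (μ i)) :
    Measure.pi (fun i => (μ i).withDensity fun x => ENNReal.ofReal (f i x)) =
      (Measure.pi μ).withDensity fun x => ENNReal.ofReal (∏ i, f i (x i)) := by
  have (i : ι) := isFiniteMeasure_withDensity_ofReal (hint i).hasFiniteIntegral
  refine Measure.pi_eq fun s hs => ?_
  rw [withDensity_apply _ (.univ_pi hs), Measure.restrict_pi_pi,
    ← ofReal_integral_eq_lintegral_ofReal
      (Integrable.fintype_prod_dep fun i => (hint i).restrict)
      (.of_forall fun x => Finset.prod_nonneg fun i _ => hf i (x i)),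
    integral_fintype_prod_eq_prod,
    ENNReal.ofReal_prod_of_nonneg fun i _ => integral_nonneg (hf i)]
  refine Finset.prod_congr rfl fun i _ => ?_
  rw [withDensity_apply _ (hs i),
    ofReal_integral_eq_lintegral_ofReal (hint i).restrict (.of_forall (hf i))]

end DensityTransformations

section MultivariateNormal

variable {ι κ : Type*} [Fintype ι] [DecidableEq ι] [Fintype κ] [DecidableEq κ]

/-- The normal distribution `N(m, S)` on `ι → ℝ` for positive definite `S`, given by its density.
Mathlib's `multivariateGaussian` also allows degenerate covariances, but is a measure on
`EuclideanSpace ℝ ι`, for which no density is available. -/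
def multivariateNormal (m : ι → ℝ) (S : Matrix ι ι ℝ) : Measure (ι → ℝ) :=
  volume.withDensity fun x => ENNReal.ofReal (gaussianDensity m S x)

lemma multivariateNormal_one (m : ι → ℝ) :
    multivariateNormal m 1 = Measure.pi fun i => gaussianReal (m i) 1 := by
  simp only [gaussianReal_of_var_ne_zero _ one_ne_zero, gaussianPDF_def]
  rw [pi_withDensity_ofReal (fun i => gaussianPDFReal_nonneg (m i) 1)
    fun i => integrable_gaussianPDFReal (m i) 1, multivariateNormal, volume_pi]
  simp only [gaussianDensity_one]

lemma map_affine_multivariateNormal (a m : ι → ℝ) {B : Matrix ι ι ℝ} (hB : B.det ≠ 0)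
    (S : Matrix ι ι ℝ) :
    (multivariateNormal m S).map (fun x => a + B *ᵥ x) =
      multivariateNormal (a + B *ᵥ m) (B * S * Bᵀ) := by
  have hdet : 0 < |B.det| := abs_pos.2 hB
  have hdensity : (fun x => ENNReal.ofReal (gaussianDensity m S x)) =
      (fun y => ENNReal.ofReal |B.det| *
        ENNReal.ofReal (gaussianDensity (a + B *ᵥ m) (B * S * Bᵀ) y)) ∘ fun x => a + B *ᵥ x := by
    ext x
    rw [Function.comp_apply, gaussianDensity_affine hB, ← ENNReal.ofReal_mul hdet.le,
      mul_inv_cancel_left₀ hdet.ne']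
  have hmeas := measurable_ofReal_gaussianDensity (a + B *ᵥ m) (B * S * Bᵀ)
  rw [multivariateNormal, hdensity,
    map_withDensity_comp (measurePreserving_affine a hB) (hmeas.const_mul _),
    withDensity_smul_measure]
  change _ • volume.withDensity (ENNReal.ofReal |B.det| • _) = _
  rw [withDensity_smul _ hmeas, smul_smul, ← ENNReal.ofReal_mul (abs_nonneg _), ← abs_mul,
    inv_mul_cancel₀ hB, abs_one, ENNReal.ofReal_one, one_smul, multivariateNormal]

lemma exists_eq_mul_transpose_of_posDef {S : Matrix ι ι ℝ} (hS : S.PosDef) :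
    ∃ B : Matrix ι ι ℝ, B.det ≠ 0 ∧ S = B * Bᵀ := by
  open scoped MatrixOrder in
  obtain ⟨B, hB⟩ := CStarAlgebra.nonneg_iff_eq_star_mul_self.1 hS.posSemidef.nonneg
  have hS' : S = Bᵀ * Bᵀᵀ := by
    rw [hB, Matrix.star_eq_conjTranspose, Matrix.conjTranspose_eq_transpose_of_trivial,
      Matrix.transpose_transpose]
  refine ⟨Bᵀ, fun hdet => hS.det_pos.ne' ?_, hS'⟩
  rw [hS', Matrix.det_mul, hdet, zero_mul]

lemma isProbabilityMeasure_multivariateNormal (m : ι → ℝ) {S : Matrix ι ι ℝ} (hS : S.PosDef) :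
    IsProbabilityMeasure (multivariateNormal m S) := by
  obtain ⟨B, hB, rfl⟩ := exists_eq_mul_transpose_of_posDef hS
  have hmap := map_affine_multivariateNormal m 0 hB 1
  rw [Matrix.mulVec_zero, add_zero, Matrix.mul_one, multivariateNormal_one] at hmap
  rw [← hmap]
  exact Measure.isProbabilityMeasure_map (by fun_prop)

lemma lintegral_gaussianDensity (m : ι → ℝ) {S : Matrix ι ι ℝ} (hS : S.PosDef) :
    ∫⁻ x, ENNReal.ofReal (gaussianDensity m S x) = 1 := by
  have := isProbabilityMeasure_multivariateNormal m hS
  rw [← measure_univ (μ := multivariateNormal m S), multivariateNormal,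
    withDensity_apply _ MeasurableSet.univ, setLIntegral_univ]

lemma integrable_gaussianDensity (m : ι → ℝ) {S : Matrix ι ι ℝ} (hS : S.PosDef) :
    Integrable (gaussianDensity m S) := by
  refine (lintegral_ofReal_ne_top_iff_integrable
    (continuous_gaussianDensity m S).aestronglyMeasurable
    (.of_forall (gaussianDensity_nonneg m S))).1 ?_
  rw [lintegral_gaussianDensity m hS]
  exact ENNReal.one_ne_top

lemma integral_gaussianDensity (m : ι → ℝ) {S : Matrix ι ι ℝ} (hS : S.PosDef) :
    ∫ x, gaussianDensity m S x = 1 := by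
  rw [integral_eq_lintegral_of_nonneg_ae (.of_forall (gaussianDensity_nonneg m S))
    (continuous_gaussianDensity m S).aestronglyMeasurable, lintegral_gaussianDensity m hS,
    ENNReal.toReal_one]

lemma map_sumElim_prod_multivariateNormal (m : ι → ℝ) (n : κ → ℝ) {A : Matrix ι ι ℝ}
    {D : Matrix κ κ ℝ} (hA : 0 < A.det) (hD : 0 < D.det) :
    ((multivariateNormal m A).prod (multivariateNormal n D)).map
        (fun q : (ι → ℝ) × (κ → ℝ) => (Sum.elim q.1 q.2 : ι ⊕ κ → ℝ)) =
      multivariateNormal (Sum.elim m n) (Matrix.fromBlocks A 0 0 D) := by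
  have hφ : MeasurePreserving (fun q : (ι → ℝ) × (κ → ℝ) => (Sum.elim q.1 q.2 : ι ⊕ κ → ℝ)) := by
    have heq : (fun q : (ι → ℝ) × (κ → ℝ) => (Sum.elim q.1 q.2 : ι ⊕ κ → ℝ)) =
        (MeasurableEquiv.sumPiEquivProdPi fun _ : ι ⊕ κ => ℝ).symm := by
      ext q (i | i) <;> rfl
    exact heq ▸ volume_measurePreserving_sumPiEquivProdPi_symm fun _ : ι ⊕ κ => ℝ
  have hmeas := measurable_ofReal_gaussianDensity (Sum.elim m n) (Matrix.fromBlocks A 0 0 D)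
  rw [multivariateNormal, multivariateNormal, prod_withDensity
    (measurable_ofReal_gaussianDensity m A) (measurable_ofReal_gaussianDensity n D),
    multivariateNormal, ← map_withDensity_comp hφ hmeas]
  congr 2 with q
  rw [Function.comp_apply, gaussianDensity_fromBlocks hA hD,
    ENNReal.ofReal_mul (gaussianDensity_nonneg _ _ _)]

end MultivariateNormal

section GaussianVectors

variable {ι κ Ω : Type*} [Fintype ι] [MeasurableSpace Ω] {P : Measure Ω}

lemma covariance_mulVec [IsFiniteMeasure P] {X : ι → Ω → ℝ} (hX : ∀ i, MemLp (X i) 2 P)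
    {S : Matrix ι ι ℝ} (hS : ∀ i j, cov[X i, X j; P] = S i j) (A : Matrix κ ι ℝ) (i j : κ) :
    cov[fun ω => (A *ᵥ (X · ω)) i, fun ω => (A *ᵥ (X · ω)) j; P] = (A * S * Aᵀ) i j := by
  simp only [Matrix.mulVec, dotProduct]
  rw [covariance_fun_sum_fun_sum (fun k => (hX k).const_mul _) fun k => (hX k).const_mul _]
  simp only [covariance_const_mul_left, covariance_const_mul_right, hS, Matrix.mul_apply,
    Matrix.transpose_apply, Finset.sum_mul]
  rw [Finset.sum_comm]
  exact Finset.sum_congr rfl fun k _ => Finset.sum_congr rfl fun l _ => by ring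

lemma integral_mulVec {X : ι → Ω → ℝ} (hX : ∀ i, Integrable (X i) P) (A : Matrix κ ι ℝ) (i : κ) :
    ∫ ω, (A *ᵥ (X · ω)) i ∂P = (A *ᵥ fun j => ∫ ω, X j ω ∂P) i := by
  simp only [Matrix.mulVec, dotProduct]
  rw [integral_finsetSum _ fun k _ => (hX k).const_mul _]
  simp only [integral_const_mul]

lemma map_eq_multivariateNormal_one [DecidableEq ι] {X : ι → Ω → ℝ}
    (hX : HasGaussianLaw (fun ω i => X i ω) P)
    (hcov : ∀ i j, cov[X i, X j; P] = (1 : Matrix ι ι ℝ) i j) :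
    P.map (fun ω i => X i ω) = multivariateNormal (fun i => ∫ ω, X i ω ∂P) 1 := by
  have := hX.isProbabilityMeasure
  have hindep : iIndepFun X P := hX.iIndepFun_of_covariance_eq_zero fun i j hij => by
    rw [hcov, Matrix.one_apply_ne hij]
  have hlaw (i : ι) : P.map (X i) = gaussianReal (∫ ω, X i ω ∂P) 1 := by
    rw [(hX.eval i).map_eq_gaussianReal, ← covariance_self (hX.eval i).aemeasurable, hcov,
      Matrix.one_apply_eq, Real.toNNReal_one]
  rw [(iIndepFun_iff_map_fun_eq_pi_map fun i => (hX.eval i).aemeasurable).1 hindep,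
    multivariateNormal_one]
  simp only [hlaw]

lemma map_eq_multivariateNormal [DecidableEq ι] {X : ι → Ω → ℝ}
    (hX : HasGaussianLaw (fun ω i => X i ω) P) {S : Matrix ι ι ℝ} (hS : S.PosDef)
    (hcov : ∀ i j, cov[X i, X j; P] = S i j) :
    P.map (fun ω i => X i ω) = multivariateNormal (fun i => ∫ ω, X i ω ∂P) S := by
  have := hX.isProbabilityMeasure
  obtain ⟨B, hB, rfl⟩ := exists_eq_mul_transpose_of_posDef hS
  have hL2 (i : ι) : MemLp (X i) 2 P := (hX.eval i).memLp_two
  have hwhite : HasGaussianLaw (fun ω => B⁻¹ *ᵥ (X · ω)) P := by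
    simpa using hX.map_fun (LinearMap.toContinuousLinearMap (Matrix.mulVecLin B⁻¹))
  have hlaw := map_eq_multivariateNormal_one (X := fun i ω => (B⁻¹ *ᵥ (X · ω)) i) hwhite
    fun i j => by
      rw [covariance_mulVec hL2 hcov, ← Matrix.mul_assoc, Matrix.nonsing_inv_mul _ hB.isUnit,
        Matrix.one_mul, Matrix.transpose_nonsing_inv,
        Matrix.mul_nonsing_inv _ (B.isUnit_det_transpose hB.isUnit)]
  simp only [integral_mulVec fun i => (hL2 i).integrable one_le_two] at hlaw
  have hmap := congrArg (Measure.map fun w => 0 + B *ᵥ w) hlaw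
  rw [map_affine_multivariateNormal _ _ hB,
    AEMeasurable.map_map_of_aemeasurable (by fun_prop) hwhite.aemeasurable] at hmap
  simpa only [Function.comp_def, zero_add, Matrix.mul_one, Matrix.mulVec_mulVec,
    Matrix.mul_nonsing_inv _ hB.isUnit, Matrix.one_mulVec] using hmap

omit [Fintype ι] in
lemma hasGaussianLaw_comp_of_isGaussianProcess [Finite ι] {T : Type*} {X : T → Ω → ℝ}
    (hX : IsGaussianProcess X P) (D : ι → T) : HasGaussianLaw (fun ω i => X (D i) ω) P := by
  have := Fintype.ofFinite ι
  exact ((hX.comp_right D).hasGaussianLaw Finset.univ).map_fun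
    (ContinuousLinearMap.pi fun i : ι =>
      ContinuousLinearMap.proj (⟨i, Finset.mem_univ i⟩ : (Finset.univ : Finset ι)))

end GaussianVectors

section NormalInvGamma

variable {κ : Type*} [Fintype κ] [DecidableEq κ]

/-- The normal-inverse-gamma distribution: the joint density of `(β, s)` when `s ~ IG(a, Q)` and
`β | s ~ N(m, s • B)`. -/
def normalInvGammaDensity (m : κ → ℝ) (B : Matrix κ κ ℝ) (a Q : ℝ) (q : (κ → ℝ) × ℝ) : ℝ :=
  gaussianDensity m (q.2 • B) q.1 * invGammaDensity a Q q.2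

lemma normalInvGammaDensity_of_nonpos (m : κ → ℝ) (B : Matrix κ κ ℝ) (a Q : ℝ) (β : κ → ℝ) {s : ℝ}
    (hs : s ≤ 0) : normalInvGammaDensity m B a Q (β, s) = 0 := by
  rw [normalInvGammaDensity, invGammaDensity_of_nonpos a Q hs, mul_zero]

lemma normalInvGammaDensity_nonneg (m : κ → ℝ) (B : Matrix κ κ ℝ) {a Q : ℝ} (ha : 0 < a)
    (hQ : 0 < Q) (q : (κ → ℝ) × ℝ) : 0 ≤ normalInvGammaDensity m B a Q q :=
  mul_nonneg (gaussianDensity_nonneg _ _ _) (invGammaDensity_nonneg ha hQ _)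

lemma exists_normalInvGammaDensity_eq_varianceKernel {B : Matrix κ κ ℝ} (hB : 0 < B.det) {a Q : ℝ}
    (ha : 0 < a) (hQ : 0 < Q) :
    ∃ C, 0 < C ∧ ∀ (m β : κ → ℝ) (s : ℝ), 0 < s → normalInvGammaDensity m B a Q (β, s) =
      C * varianceKernel (Fintype.card κ / 2 + (a + 1))
        ((β - m) ⬝ᵥ (B⁻¹ *ᵥ (β - m)) / 2 + Q) s := by
  obtain ⟨C, hC, hgaussian⟩ := exists_gaussianDensity_smul_eq_varianceKernel hB
  obtain ⟨C', hC', hinvGamma⟩ := exists_invGammaDensity_eq_varianceKernel ha hQ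
  refine ⟨C * C', mul_pos hC hC', fun m β s hs => ?_⟩
  rw [normalInvGammaDensity, hgaussian m β s hs, hinvGamma s hs, mul_mul_mul_comm,
    varianceKernel_mul_varianceKernel _ _ _ _ hs]

lemma measurable_normalInvGammaDensity (m : κ → ℝ) {B : Matrix κ κ ℝ} (hB : 0 < B.det) (a Q : ℝ) :
    Measurable (normalInvGammaDensity m B a Q) := by
  obtain ⟨C, -, hgaussian⟩ := exists_gaussianDensity_smul_eq_varianceKernel hB
  have heq : normalInvGammaDensity m B a Q = fun q =>
      C * varianceKernel (Fintype.card κ / 2) ((q.1 - m) ⬝ᵥ (B⁻¹ *ᵥ (q.1 - m)) / 2) q.2 *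
        invGammaDensity a Q q.2 := by
    ext ⟨β, s⟩
    rcases le_or_gt s 0 with hs | hs
    · rw [normalInvGammaDensity_of_nonpos m B a Q β hs, invGammaDensity_of_nonpos a Q hs, mul_zero]
    · rw [normalInvGammaDensity, hgaussian m β s hs]
  have hquad : Measurable fun q : (κ → ℝ) × ℝ => (q.1 - m) ⬝ᵥ (B⁻¹ *ᵥ (q.1 - m)) :=
    Continuous.measurable (by fun_prop)
  have hinvGamma := measurable_invGammaDensity a Q
  rw [heq]
  unfold varianceKernel
  fun_prop

lemma integral_normalInvGammaDensity_coef (m : κ → ℝ) {B : Matrix κ κ ℝ} (hB : B.PosDef)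
    (a Q s : ℝ) : ∫ β, normalInvGammaDensity m B a Q (β, s) = invGammaDensity a Q s := by
  rcases le_or_gt s 0 with hs | hs
  · simp only [normalInvGammaDensity_of_nonpos m B a Q _ hs, invGammaDensity_of_nonpos a Q hs,
      integral_zero]
  · simp only [normalInvGammaDensity]
    rw [integral_mul_const, integral_gaussianDensity m (hB.smul hs), one_mul]

lemma integrable_normalInvGammaDensity (m : κ → ℝ) {B : Matrix κ κ ℝ} (hB : B.PosDef) {a Q : ℝ}
    (ha : 0 < a) (hQ : 0 < Q) : Integrable (normalInvGammaDensity m B a Q) := by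
  refine (integrable_prod_iff'
    (measurable_normalInvGammaDensity m hB.det_pos a Q).aestronglyMeasurable).2
    ⟨.of_forall fun s => ?_, ?_⟩
  · rcases le_or_gt s 0 with hs | hs
    · simp only [normalInvGammaDensity_of_nonpos m B a Q _ hs]
      exact integrable_zero _ _ _
    · exact (integrable_gaussianDensity m (hB.smul hs)).mul_const (invGammaDensity a Q s)
  · simp only [Real.norm_of_nonneg (normalInvGammaDensity_nonneg m B ha hQ _),
      integral_normalInvGammaDensity_coef m hB]
    exact integrable_invGammaDensity ha hQ

lemma integral_normalInvGammaDensity (m : κ → ℝ) {B : Matrix κ κ ℝ} (hB : B.PosDef) {a Q : ℝ}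
    (ha : 0 < a) (hQ : 0 < Q) : ∫ q, normalInvGammaDensity m B a Q q = 1 := by
  rw [Measure.volume_eq_prod,
    integral_prod_symm _ (integrable_normalInvGammaDensity m hB ha hQ)]
  simp only [integral_normalInvGammaDensity_coef m hB]
  exact integral_invGammaDensity ha hQ

end NormalInvGamma

section LeastSquares

variable {ι κ : Type*} [Fintype ι] [DecidableEq ι] [Fintype κ] [DecidableEq κ] {F : Matrix ι κ ℝ}
  {R : Matrix ι ι ℝ} {y : ι → ℝ}

omit [Fintype κ] [DecidableEq κ] in
lemma posDef_transpose_mul_inv_mul [Finite κ] (hR : R.PosDef) (hF : LinearIndependent ℝ F.col) :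
    (Fᵀ * R⁻¹ * F).PosDef := by
  have := Fintype.ofFinite κ
  rw [← Matrix.conjTranspose_eq_transpose_of_trivial]
  exact hR.inv.conjTranspose_mul_mul_same (Matrix.mulVec_injective_iff.2 hF)

omit [DecidableEq ι] [DecidableEq κ] in
lemma card_lt_card_of_forall_mulVec_ne (hF : LinearIndependent ℝ F.col) (hy : ∀ β, F *ᵥ β ≠ y) :
    Fintype.card κ < Fintype.card ι := by
  have hrange : LinearMap.range F.mulVecLin ≠ ⊤ := fun htop =>
    let ⟨β, hβ⟩ := LinearMap.range_eq_top.1 htop y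
    hy β hβ
  have hlt := Submodule.finrank_lt hrange
  rwa [LinearMap.finrank_range_of_inj (Matrix.mulVec_injective_iff.2 hF),
    Module.finrank_fintype_fun_eq_card, Module.finrank_fintype_fun_eq_card] at hlt

namespace LevelPrior

lemma transpose_mul_inv_mul_mulVec_gls (hG : (Fᵀ * R⁻¹ * F).PosDef) (y : ι → ℝ) :
    (Fᵀ * R⁻¹ * F) *ᵥ gls F R y = (Fᵀ * R⁻¹) *ᵥ y := by
  rw [gls, Matrix.mulVec_mulVec, Matrix.mul_nonsing_inv _ hG.det_pos.ne'.isUnit, Matrix.one_mulVec]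

lemma residual_eq_sub (hR : R.IsSymm) (y : ι → ℝ) :
    residual F R y = y ⬝ᵥ (R⁻¹ *ᵥ y) -
      ((Fᵀ * R⁻¹) *ᵥ y) ⬝ᵥ ((Fᵀ * R⁻¹ * F)⁻¹ *ᵥ ((Fᵀ * R⁻¹) *ᵥ y)) := by
  rw [residual, Matrix.sub_mulVec, dotProduct_sub, mulVec_dotProduct, Matrix.transpose_mul,
    Matrix.transpose_transpose, hR.inv.eq]
  simp only [Matrix.mulVec_mulVec, Matrix.mul_assoc]

lemma quadratic_eq_gls_add_residual (hR : R.PosDef) (hF : LinearIndependent ℝ F.col) (y : ι → ℝ)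
    (β : κ → ℝ) :
    (y - F *ᵥ β) ⬝ᵥ (R⁻¹ *ᵥ (y - F *ᵥ β)) =
      (β - gls F R y) ⬝ᵥ ((Fᵀ * R⁻¹ * F) *ᵥ (β - gls F R y)) + residual F R y := by
  have hRs := Matrix.isHermitian_iff_isSymm.1 hR.isHermitian
  have hG := posDef_transpose_mul_inv_mul hR hF
  have hsquare := dotProduct_mulVec_sub_two_mul (Matrix.isHermitian_iff_isSymm.1 hG.isHermitian)
    hG.isUnit β ((Fᵀ * R⁻¹) *ᵥ y)
  have hcross : (F *ᵥ β) ⬝ᵥ (R⁻¹ *ᵥ y) = β ⬝ᵥ ((Fᵀ * R⁻¹) *ᵥ y) := by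
    rw [mulVec_dotProduct, Matrix.mulVec_mulVec]
  have hfit : (F *ᵥ β) ⬝ᵥ (R⁻¹ *ᵥ (F *ᵥ β)) = β ⬝ᵥ ((Fᵀ * R⁻¹ * F) *ᵥ β) := by
    rw [mulVec_dotProduct, Matrix.mulVec_mulVec, Matrix.mulVec_mulVec]
  rw [sub_dotProduct_mulVec_sub hRs.inv, dotProduct_mulVec_comm_of_isSymm hRs.inv y (F *ᵥ β),
    hcross, hfit, residual_eq_sub hRs, gls]
  linear_combination hsquare

lemma residual_eq_quadratic_gls (hR : R.PosDef) (hF : LinearIndependent ℝ F.col) (y : ι → ℝ) :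
    residual F R y = (y - F *ᵥ gls F R y) ⬝ᵥ (R⁻¹ *ᵥ (y - F *ᵥ gls F R y)) := by
  rw [quadratic_eq_gls_add_residual hR hF, sub_self, zero_dotProduct, zero_add]

lemma residual_nonneg (hR : R.PosDef) (hF : LinearIndependent ℝ F.col) (y : ι → ℝ) :
    0 ≤ residual F R y := by
  rw [residual_eq_quadratic_gls hR hF]
  exact hR.inv.posSemidef.dotProduct_mulVec_nonneg (y - F *ᵥ gls F R y)

lemma residual_pos (hR : R.PosDef) (hF : LinearIndependent ℝ F.col) (hy : ∀ β, F *ᵥ β ≠ y) :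
    0 < residual F R y := by
  rw [residual_eq_quadratic_gls hR hF]
  exact hR.inv.dotProduct_mulVec_pos (sub_ne_zero.2 (hy (gls F R y)).symm)

end LevelPrior

end LeastSquares

namespace LevelPrior

variable {ι κ : Type*} [Fintype ι] [DecidableEq ι] [Fintype κ] [DecidableEq κ] {π : LevelPrior κ}
  {F : Matrix ι κ ℝ} {R : Matrix ι ι ℝ} {y : ι → ℝ}

omit [Fintype κ] [DecidableEq κ] in
lemma varDensity_of_nonpos (π : LevelPrior κ) {s : ℝ} (hs : s ≤ 0) : π.varDensity s = 0 := by
  cases π with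
  | informative α γ b v => exact invGammaDensity_of_nonpos α γ hs
  | jeffreys c c' => exact if_neg hs.not_gt

omit [DecidableEq ι] [DecidableEq κ] in
lemma postShape_pos (hπ : π.Valid) (hF : LinearIndependent ℝ F.col)
    (hy : π.IsJeffreys → ∀ β, F *ᵥ β ≠ y) : 0 < π.postShape ι := by
  cases π with
  | informative α γ b v => exact add_pos_of_nonneg_of_pos (by positivity) hπ.1
  | jeffreys c c' =>
    exact half_pos (sub_pos.2 (Nat.cast_lt.2 (card_lt_card_of_forall_mulVec_ne hF (hy trivial))))

lemma postQ_pos (hπ : π.Valid) (hR : R.PosDef) (hF : LinearIndependent ℝ F.col)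
    (hy : π.IsJeffreys → ∀ β, F *ᵥ β ≠ y) : 0 < π.postQ F R y := by
  cases π with
  | informative α γ b v =>
    obtain ⟨-, hγ, hv⟩ := hπ
    have hshrink := ((Matrix.PosDef.diagonal hv).add
      (posDef_transpose_mul_inv_mul hR hF).inv).inv.posSemidef.dotProduct_mulVec_nonneg
        (b - gls F R y)
    exact add_pos_of_pos_of_nonneg (add_pos_of_pos_of_nonneg (by positivity) hshrink)
      (residual_nonneg hR hF y)
  | jeffreys c c' => exact residual_pos hR hF (hy trivial)

/-- The precision matrix of the coefficients given the data and unit variance. -/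
def postPrecision (π : LevelPrior κ) (F : Matrix ι κ ℝ) (R : Matrix ι ι ℝ) : Matrix κ κ ℝ :=
  match π with
  | informative _ _ _ v => Fᵀ * R⁻¹ * F + (Matrix.diagonal v)⁻¹
  | jeffreys _ _ => Fᵀ * R⁻¹ * F

/-- The mean `A ν` of the coefficients given the data, which does not depend on the variance. -/
def postMean (π : LevelPrior κ) (F : Matrix ι κ ℝ) (R : Matrix ι ι ℝ) (y : ι → ℝ) : κ → ℝ :=
  (π.postPrecision F R)⁻¹ *ᵥ π.postVec F R y 1

lemma posDef_postPrecision (hπ : π.Valid) (hR : R.PosDef) (hF : LinearIndependent ℝ F.col) :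
    (π.postPrecision F R).PosDef := by
  cases π with
  | informative α γ b v =>
    exact (posDef_transpose_mul_inv_mul hR hF).add (Matrix.PosDef.diagonal hπ.2.2).inv
  | jeffreys c c' => exact posDef_transpose_mul_inv_mul hR hF

lemma postCov_eq_smul (hM : (π.postPrecision F R).PosDef) {s : ℝ} (hs : s ≠ 0) :
    π.postCov F R s = s • (π.postPrecision F R)⁻¹ := by
  have hprecision : π.postCov F R s = (s⁻¹ • π.postPrecision F R)⁻¹ := by
    cases π <;> simp only [postCov, postPrecision, Matrix.mul_smul, Matrix.smul_mul, smul_add]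
  rw [hprecision, matrix_inv_smul_of_ne_zero (inv_ne_zero hs) hM.det_pos.ne', inv_inv]

lemma postVec_eq_smul (π : LevelPrior κ) (F : Matrix ι κ ℝ) (R : Matrix ι ι ℝ) (y : ι → ℝ)
    (s : ℝ) : π.postVec F R y s = s⁻¹ • π.postVec F R y 1 := by
  cases π <;> simp only [postVec, Matrix.mul_smul, Matrix.smul_mulVec, smul_add, inv_one, one_smul]

lemma postCov_mulVec_postVec (hM : (π.postPrecision F R).PosDef) (y : ι → ℝ) {s : ℝ} (hs : s ≠ 0) :
    π.postCov F R s *ᵥ π.postVec F R y s = π.postMean F R y := by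
  rw [postCov_eq_smul hM hs, postVec_eq_smul, Matrix.smul_mulVec, Matrix.mulVec_smul,
    smul_inv_smul₀ hs, postMean]

/-- The exponent `e` in `prior ∝ s ^ (-e) * exp (-E(β) / s)`. -/
def priorExponent (π : LevelPrior κ) : ℝ :=
  match π with
  | informative α _ _ _ => (Fintype.card κ : ℝ) / 2 + (α + 1)
  | jeffreys _ _ => 1

/-- The energy `E(β)` in `prior ∝ s ^ (-e) * exp (-E(β) / s)`. -/
def priorEnergy (π : LevelPrior κ) (β : κ → ℝ) : ℝ :=
  match π with
  | informative _ γ b v => (β - b) ⬝ᵥ ((Matrix.diagonal v)⁻¹ *ᵥ (β - b)) / 2 + γ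
  | jeffreys _ _ => 0

lemma exists_prior_eq_varianceKernel (hπ : π.Valid) :
    ∃ C, 0 < C ∧ ∀ (β : κ → ℝ) (s : ℝ), 0 < s → π.coefDensity s β * π.varDensity s =
      C * varianceKernel π.priorExponent (π.priorEnergy β) s := by
  cases π with
  | informative α γ b v =>
    obtain ⟨C, hC, hprior⟩ := exists_normalInvGammaDensity_eq_varianceKernel
      (Matrix.PosDef.diagonal hπ.2.2).det_pos hπ.1 hπ.2.1
    exact ⟨C, hC, fun β s hs => hprior b β s hs⟩
  | jeffreys c c' =>
    refine ⟨c * c', mul_pos hπ.1 hπ.2, fun β s hs => ?_⟩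
    rw [coefDensity, varDensity, if_pos hs, varianceKernel, priorExponent, priorEnergy, zero_div,
      neg_zero, Real.exp_zero, mul_one, Real.rpow_neg_one, mul_assoc, div_eq_mul_inv]

omit [DecidableEq ι] [DecidableEq κ] in
lemma card_add_priorExponent (π : LevelPrior κ) :
    (Fintype.card ι : ℝ) / 2 + π.priorExponent =
      (Fintype.card κ : ℝ) / 2 + (π.postShape ι + 1) := by
  cases π <;> simp only [priorExponent, postShape] <;> ring

lemma quadratic_add_priorEnergy (hπ : π.Valid) (hR : R.PosDef) (hF : LinearIndependent ℝ F.col)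
    (y : ι → ℝ) (β : κ → ℝ) :
    (y - F *ᵥ β) ⬝ᵥ (R⁻¹ *ᵥ (y - F *ᵥ β)) / 2 + π.priorEnergy β =
      (β - π.postMean F R y) ⬝ᵥ (π.postPrecision F R *ᵥ (β - π.postMean F R y)) / 2 +
        π.postQ F R y / 2 := by
  have hG := posDef_transpose_mul_inv_mul hR hF
  have hgls := transpose_mul_inv_mul_mulVec_gls hG y
  rw [quadratic_eq_gls_add_residual hR hF]
  cases π with
  | informative α γ b v =>
    have hV := Matrix.PosDef.diagonal hπ.2.2
    have hsquare := dotProduct_mulVec_sub_add_sub hG.isUnit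
      (Matrix.isHermitian_iff_isSymm.1 hG.isHermitian) hV.inv.isUnit
      (Matrix.isHermitian_iff_isSymm.1 hV.inv.isHermitian) (hG.add hV.inv).isUnit
      β (gls F R y) b
    rw [hgls, Matrix.nonsing_inv_nonsing_inv _ hV.det_pos.ne'.isUnit] at hsquare
    simp only [priorEnergy, postMean, postPrecision, postVec, postQ, inv_one, one_smul]
    linear_combination hsquare / 2
  | jeffreys c c' =>
    have hmean : (jeffreys c c').postMean F R y = gls F R y := by
      rw [postMean, postPrecision, postVec, inv_one, one_smul, gls]
    rw [hmean, priorEnergy, postPrecision, postQ]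
    ring

/-- The posterior density of `(β, s)` for the regression model `y ~ N(F β, s • R)`. -/
def posteriorDensity (π : LevelPrior κ) (F : Matrix ι κ ℝ) (R : Matrix ι ι ℝ) (y : ι → ℝ)
    (q : (κ → ℝ) × ℝ) : ℝ :=
  gaussianDensity (π.postCov F R q.2 *ᵥ π.postVec F R y q.2) (π.postCov F R q.2) q.1 *
    invGammaDensity (π.postShape ι) (π.postQ F R y / 2) q.2

lemma posteriorDensity_eq_normalInvGammaDensity (hM : (π.postPrecision F R).PosDef) (y : ι → ℝ) :
    π.posteriorDensity F R y = normalInvGammaDensity (π.postMean F R y) (π.postPrecision F R)⁻¹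
      (π.postShape ι) (π.postQ F R y / 2) := by
  ext ⟨β, s⟩
  rcases le_or_gt s 0 with hs | hs
  · rw [normalInvGammaDensity_of_nonpos _ _ _ _ _ hs, posteriorDensity,
      invGammaDensity_of_nonpos _ _ hs, mul_zero]
  · rw [posteriorDensity, postCov_mulVec_postVec hM y hs.ne', postCov_eq_smul hM hs.ne',
      normalInvGammaDensity]

/-- The assumptions on one level: with the non-informative prior, the data must not be fitted
exactly by the regression. -/
structure IsRegular (π : LevelPrior κ) (F : Matrix ι κ ℝ) (R : Matrix ι ι ℝ) (y : ι → ℝ) :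
    Prop where
  valid : π.Valid
  posDef : R.PosDef
  linearIndependent : LinearIndependent ℝ F.col
  mulVec_ne : π.IsJeffreys → ∀ β, F *ᵥ β ≠ y

namespace IsRegular

lemma posDef_postPrecision (h : π.IsRegular F R y) : (π.postPrecision F R).PosDef :=
  LevelPrior.posDef_postPrecision h.valid h.posDef h.linearIndependent

omit [DecidableEq ι] [DecidableEq κ] in
lemma postShape_pos (h : π.IsRegular F R y) : 0 < π.postShape ι :=
  LevelPrior.postShape_pos h.valid h.linearIndependent h.mulVec_ne

lemma half_postQ_pos (h : π.IsRegular F R y) : 0 < π.postQ F R y / 2 :=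
  half_pos (postQ_pos h.valid h.posDef h.linearIndependent h.mulVec_ne)

lemma exists_likelihood_mul_prior_eq (h : π.IsRegular F R y) :
    ∃ C, 0 < C ∧ ∀ q : (κ → ℝ) × ℝ,
      gaussianDensity (F *ᵥ q.1) (q.2 • R) y * (π.coefDensity q.2 q.1 * π.varDensity q.2) =
        C * π.posteriorDensity F R y q := by
  have hM := h.posDef_postPrecision
  obtain ⟨C, hC, hlikelihood⟩ := exists_gaussianDensity_smul_eq_varianceKernel h.posDef.det_pos
  obtain ⟨C', hC', hprior⟩ := exists_prior_eq_varianceKernel h.valid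
  obtain ⟨C'', hC'', hposterior⟩ := exists_normalInvGammaDensity_eq_varianceKernel
    hM.inv.det_pos h.postShape_pos h.half_postQ_pos
  refine ⟨C * C' / C'', by positivity, fun ⟨β, s⟩ => ?_⟩
  rw [posteriorDensity_eq_normalInvGammaDensity hM]
  rcases le_or_gt s 0 with hs | hs
  · rw [varDensity_of_nonpos π hs, normalInvGammaDensity_of_nonpos _ _ _ _ _ hs, mul_zero, mul_zero,
      mul_zero]
  · rw [hlikelihood _ _ s hs, hprior β s hs, hposterior _ β s hs,
      Matrix.nonsing_inv_nonsing_inv _ hM.det_pos.ne'.isUnit, mul_mul_mul_comm,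
      varianceKernel_mul_varianceKernel _ _ _ _ hs, card_add_priorExponent,
      quadratic_add_priorEnergy h.valid h.posDef h.linearIndependent]
    field_simp

lemma normalizesTo_posteriorDensity (h : π.IsRegular F R y) :
    NormalizesTo volume (fun q : (κ → ℝ) × ℝ => gaussianDensity (F *ᵥ q.1) (q.2 • R) y *
      (π.coefDensity q.2 q.1 * π.varDensity q.2)) (π.posteriorDensity F R y) where
  exists_eq_const_mul := h.exists_likelihood_mul_prior_eq
  integrable := by
    rw [posteriorDensity_eq_normalInvGammaDensity h.posDef_postPrecision]
    exact integrable_normalInvGammaDensity _ h.posDef_postPrecision.inv h.postShape_pos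
      h.half_postQ_pos
  integral_eq_one := by
    rw [posteriorDensity_eq_normalInvGammaDensity h.posDef_postPrecision]
    exact integral_normalInvGammaDensity _ h.posDef_postPrecision.inv h.postShape_pos
      h.half_postQ_pos

lemma integral_posteriorDensity_coef (h : π.IsRegular F R y) (s : ℝ) :
    ∫ β, π.posteriorDensity F R y (β, s) =
      invGammaDensity (π.postShape ι) (π.postQ F R y / 2) s := by
  rw [posteriorDensity_eq_normalInvGammaDensity h.posDef_postPrecision]
  exact integral_normalInvGammaDensity_coef _ h.posDef_postPrecision.inv _ _ s

lemma posteriorDensity_div_invGammaDensity (h : π.IsRegular F R y) (β : κ → ℝ) {s : ℝ}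
    (hs : 0 < s) :
    π.posteriorDensity F R y (β, s) / invGammaDensity (π.postShape ι) (π.postQ F R y / 2) s =
      gaussianDensity (π.postCov F R s *ᵥ π.postVec F R y s) (π.postCov F R s) β :=
  mul_div_cancel_right₀ _ (invGammaDensity_pos h.postShape_pos h.half_postQ_pos hs).ne'

end IsRegular

lemma posteriorDensity_div_mul_invGammaDensity (π : LevelPrior κ) (F : Matrix ι κ ℝ)
    (R : Matrix ι ι ℝ) (y : ι → ℝ) (β : κ → ℝ) (s : ℝ) :
    π.posteriorDensity F R y (β, s) / invGammaDensity (π.postShape ι) (π.postQ F R y / 2) s *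
      invGammaDensity (π.postShape ι) (π.postQ F R y / 2) s = π.posteriorDensity F R y (β, s) :=
  div_mul_cancel_of_imp fun hzero => mul_eq_zero_of_right _ hzero

end LevelPrior

namespace TwoLevelModel

variable {d n₁ n₂ p₁ p₂ : ℕ} {Θ₁ Θ₂ : Type*} (M : TwoLevelModel d n₁ n₂ p₁ p₂ Θ₁ Θ₂)

section Mixing

/-- A position in the first design of each point of the second one. -/
def nestedIndex (j : Fin n₂) : Fin n₁ := (M.nested (Set.mem_range_self j)).choose

lemma D₁_nestedIndex (j : Fin n₂) : M.D₁ (M.nestedIndex j) = M.D₂ j :=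
  (M.nested (Set.mem_range_self j)).choose_spec

/-- The matrix restricting vectors of values on the first design to the second design. -/
def selection : Matrix (Fin n₂) (Fin n₁) ℝ :=
  (1 : Matrix (Fin n₁) (Fin n₁) ℝ).submatrix M.nestedIndex id

lemma selection_mul {κ : Type*} (A : Matrix (Fin n₁) κ ℝ) :
    M.selection * A = A.submatrix M.nestedIndex id := by
  ext j k
  simp [selection, Matrix.mul_apply, Matrix.one_apply]

lemma mul_selection_transpose {κ : Type*} (A : Matrix κ (Fin n₁) ℝ) :
    A * M.selectionᵀ = A.submatrix id M.nestedIndex := by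
  ext k j
  simp [selection, Matrix.mul_apply, Matrix.one_apply]

lemma selection_mulVec_comp_D₁ (z : M.Q → ℝ) : M.selection *ᵥ (z ∘ M.D₁) = z ∘ M.D₂ := by
  ext j
  simp [selection, Matrix.mulVec, dotProduct, Matrix.one_apply, D₁_nestedIndex]

lemma selection_mul_F₁ : M.selection * M.F₁ M.D₁ = M.F₁ M.D₂ := by
  ext j k
  simp [selection_mul, F₁, D₁_nestedIndex]

lemma selection_mul_R₁ (θ₁ : Θ₁) {k : ℕ} (D : Fin k → M.Q) :
    M.selection * M.R₁ θ₁ M.D₁ D = M.R₁ θ₁ M.D₂ D := by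
  ext j i
  simp [selection_mul, R₁, D₁_nestedIndex]

lemma R₁_mul_selection_transpose (θ₁ : Θ₁) {k : ℕ} (D : Fin k → M.Q) :
    M.R₁ θ₁ D M.D₁ * M.selectionᵀ = M.R₁ θ₁ D M.D₂ := by
  ext i j
  simp [mul_selection_transpose, R₁, D₁_nestedIndex]

/-- The unipotent matrix of the map `(Z₁(D₁), δ(D₂)) ↦ (Z₁(D₁), Z₂(D₂))`. -/
def mixing (ρ : ℝ) : Matrix (Fin n₁ ⊕ Fin n₂) (Fin n₁ ⊕ Fin n₂) ℝ :=
  Matrix.fromBlocks 1 0 (ρ • M.selection) 1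

lemma det_mixing (ρ : ℝ) : (M.mixing ρ).det = 1 := by
  rw [mixing, Matrix.det_fromBlocks_zero₁₂, Matrix.det_one, Matrix.det_one, one_mul]

lemma mixing_mulVec_sumElim (ρ : ℝ) (x : Fin n₁ → ℝ) (y : Fin n₂ → ℝ) :
    M.mixing ρ *ᵥ Sum.elim x y = Sum.elim x (ρ • (M.selection *ᵥ x) + y) := by
  rw [mixing, Matrix.fromBlocks_mulVec, Sum.elim_comp_inl, Sum.elim_comp_inr, Matrix.one_mulVec,
    Matrix.one_mulVec, Matrix.zero_mulVec, add_zero, Matrix.smul_mulVec]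

lemma mixing_mulVec_comp_D₁ (ρ : ℝ) (z : M.Q → ℝ) (y : Fin n₂ → ℝ) :
    M.mixing ρ *ᵥ Sum.elim (z ∘ M.D₁) y = Sum.elim (z ∘ M.D₁) (ρ • (z ∘ M.D₂) + y) := by
  rw [mixing_mulVec_sumElim, selection_mulVec_comp_D₁]

lemma H_mulVec_eq_mixing_mulVec (ρ : ℝ) (β₁ : Fin p₁ → ℝ) (β₂ : Fin p₂ → ℝ) :
    M.H ρ *ᵥ Sum.elim β₁ β₂ =
      M.mixing ρ *ᵥ Sum.elim (M.F₁ M.D₁ *ᵥ β₁) (M.F₂ M.D₂ *ᵥ β₂) := by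
  rw [mixing_mulVec_sumElim, Matrix.mulVec_mulVec, selection_mul_F₁, H, Matrix.fromBlocks_mulVec,
    Sum.elim_comp_inl, Sum.elim_comp_inr, Matrix.zero_mulVec, add_zero, Matrix.smul_mulVec]

lemma V_eq_mixing_mul (θ₁ : Θ₁) (θ₂ : Θ₂) (ρ s₁ s₂ : ℝ) :
    M.V θ₁ θ₂ ρ s₁ s₂ = M.mixing ρ *
      Matrix.fromBlocks (s₁ • M.R₁ θ₁ M.D₁ M.D₁) 0 0 (s₂ • M.R₂ θ₂ M.D₂ M.D₂) *
        (M.mixing ρ)ᵀ := by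
  rw [mixing, Matrix.fromBlocks_transpose, Matrix.fromBlocks_multiply, Matrix.fromBlocks_multiply]
  simp [V, selection_mul_R₁, R₁_mul_selection_transpose, smul_smul, mul_comm, sq, mul_left_comm]

lemma likelihood_eq_mul_gaussianDensity {θ₁ : Θ₁} {θ₂ : Θ₂} (hR₁ : (M.R₁ θ₁ M.D₁ M.D₁).PosDef)
    (hR₂ : (M.R₂ θ₂ M.D₂ M.D₂).PosDef) {s₁ s₂ : ℝ} (hs₁ : 0 < s₁) (hs₂ : 0 < s₂)
    (β₁ : Fin p₁ → ℝ) (β₂ : Fin p₂ → ℝ) (ρ : ℝ) (z₁ z₂ : M.Q → ℝ) :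
    M.likelihood θ₁ θ₂ β₁ β₂ ρ s₁ s₂ (M.obs z₁ z₂) = M.likelihood₁ θ₁ β₁ s₁ (z₁ ∘ M.D₁) *
      gaussianDensity (M.F z₁ *ᵥ lamVec ρ β₂) (s₂ • M.R₂ θ₂ M.D₂ M.D₂) (z₂ ∘ M.D₂) := by
  have hobs : M.obs z₁ z₂ =
      M.mixing ρ *ᵥ Sum.elim (z₁ ∘ M.D₁) (z₂ ∘ M.D₂ - ρ • (z₁ ∘ M.D₂)) := by
    rw [mixing_mulVec_comp_D₁, add_sub_cancel, obs]
  have hregression : z₂ ∘ M.D₂ - ρ • (z₁ ∘ M.D₂) - M.F₂ M.D₂ *ᵥ β₂ =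
      z₂ ∘ M.D₂ - M.F z₁ *ᵥ lamVec ρ β₂ := by
    ext j
    simp [F, F₂, lamVec, Matrix.mulVec, dotProduct, sub_sub, mul_comm]
  have hchange := gaussianDensity_affine (B := M.mixing ρ) (by simp [det_mixing])
    (Matrix.fromBlocks (s₁ • M.R₁ θ₁ M.D₁ M.D₁) 0 0 (s₂ • M.R₂ θ₂ M.D₂ M.D₂)) 0
    (Sum.elim (M.F₁ M.D₁ *ᵥ β₁) (M.F₂ M.D₂ *ᵥ β₂))
    (Sum.elim (z₁ ∘ M.D₁) (z₂ ∘ M.D₂ - ρ • (z₁ ∘ M.D₂)))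
  rw [det_mixing, abs_one, inv_one, one_mul, zero_add, zero_add, ← V_eq_mixing_mul,
    ← H_mulVec_eq_mixing_mulVec, ← hobs] at hchange
  rw [likelihood, hchange, gaussianDensity_fromBlocks (hR₁.smul hs₁).det_pos
    (hR₂.smul hs₂).det_pos, likelihood₁]
  congr 1
  rw [gaussianDensity, hregression, gaussianDensity]

end Mixing

namespace IsAutoregressive

variable {M} {θ₁ : Θ₁} {θ₂ : Θ₂} {β₁ : Fin p₁ → ℝ} {β₂ : Fin p₂ → ℝ} {ρ s₁ s₂ : ℝ}
  {Ω : Type*} [MeasurableSpace Ω] {P : Measure Ω} {Z₁ Z₂ δ : M.Q → Ω → ℝ}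

lemma map_level₁_eq_multivariateNormal
    (h : M.IsAutoregressive θ₁ θ₂ β₁ β₂ ρ s₁ s₂ P Z₁ Z₂ δ)
    (hR₁ : (M.R₁ θ₁ M.D₁ M.D₁).PosDef) (hs₁ : 0 < s₁) :
    P.map (fun ω i => Z₁ (M.D₁ i) ω) =
      multivariateNormal (M.F₁ M.D₁ *ᵥ β₁) (s₁ • M.R₁ θ₁ M.D₁ M.D₁) := by
  rw [map_eq_multivariateNormal (X := fun i => Z₁ (M.D₁ i))
    (hasGaussianLaw_comp_of_isGaussianProcess h.level₁.gaussian M.D₁) (hR₁.smul hs₁)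
    fun i j => h.level₁.covariance (M.D₁ i) (M.D₁ j)]
  simp only [h.level₁.mean]
  rfl

lemma map_discrepancy_eq_multivariateNormal
    (h : M.IsAutoregressive θ₁ θ₂ β₁ β₂ ρ s₁ s₂ P Z₁ Z₂ δ)
    (hR₂ : (M.R₂ θ₂ M.D₂ M.D₂).PosDef) (hs₂ : 0 < s₂) :
    P.map (fun ω j => δ (M.D₂ j) ω) =
      multivariateNormal (M.F₂ M.D₂ *ᵥ β₂) (s₂ • M.R₂ θ₂ M.D₂ M.D₂) := by
  rw [map_eq_multivariateNormal (X := fun j => δ (M.D₂ j))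
    (hasGaussianLaw_comp_of_isGaussianProcess h.discrepancy.gaussian M.D₂) (hR₂.smul hs₂)
    fun i j => h.discrepancy.covariance (M.D₂ i) (M.D₂ j)]
  simp only [h.discrepancy.mean]
  rfl

lemma obs_eq_mixing_mulVec (h : M.IsAutoregressive θ₁ θ₂ β₁ β₂ ρ s₁ s₂ P Z₁ Z₂ δ) (ω : Ω) :
    Sum.elim (fun i => Z₁ (M.D₁ i) ω) (fun j => Z₂ (M.D₂ j) ω) =
      M.mixing ρ *ᵥ Sum.elim (fun i => Z₁ (M.D₁ i) ω) (fun j => δ (M.D₂ j) ω) := by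
  simp only [h.autoregression]
  exact (M.mixing_mulVec_comp_D₁ ρ (fun x => Z₁ x ω) fun j => δ (M.D₂ j) ω).symm

lemma map_obs_eq_multivariateNormal (h : M.IsAutoregressive θ₁ θ₂ β₁ β₂ ρ s₁ s₂ P Z₁ Z₂ δ)
    (hR₁ : (M.R₁ θ₁ M.D₁ M.D₁).PosDef) (hR₂ : (M.R₂ θ₂ M.D₂ M.D₂).PosDef) (hs₁ : 0 < s₁)
    (hs₂ : 0 < s₂) :
    P.map (fun ω => Sum.elim (fun i => Z₁ (M.D₁ i) ω) (fun j => Z₂ (M.D₂ j) ω)) =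
      multivariateNormal (M.H ρ *ᵥ Sum.elim β₁ β₂) (M.V θ₁ θ₂ ρ s₁ s₂) := by
  have := h.level₁.gaussian.isProbabilityMeasure
  have hZ₁ : AEMeasurable (fun ω i => Z₁ (M.D₁ i) ω) P :=
    (hasGaussianLaw_comp_of_isGaussianProcess h.level₁.gaussian M.D₁).aemeasurable
  have hδ : AEMeasurable (fun ω j => δ (M.D₂ j) ω) P :=
    (hasGaussianLaw_comp_of_isGaussianProcess h.discrepancy.gaussian M.D₂).aemeasurable
  have hrestrict₁ : Measurable fun (z : M.Q → ℝ) i => z (M.D₁ i) := by fun_prop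
  have hrestrict₂ : Measurable fun (z : M.Q → ℝ) j => z (M.D₂ j) := by fun_prop
  have hindep : IndepFun (fun ω i => Z₁ (M.D₁ i) ω) (fun ω j => δ (M.D₂ j) ω) P :=
    h.indep.comp hrestrict₁ hrestrict₂
  have hjoin : Measurable fun q : (Fin n₁ → ℝ) × (Fin n₂ → ℝ) => Sum.elim q.1 q.2 := by
    refine measurable_pi_iff.2 (Sum.rec (fun i => ?_) fun j => ?_)
    · exact (measurable_pi_apply i).comp measurable_fst
    · exact (measurable_pi_apply j).comp measurable_snd
  have hmixing : Measurable fun x => (0 : Fin n₁ ⊕ Fin n₂ → ℝ) + M.mixing ρ *ᵥ x := by fun_prop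
  calc P.map (fun ω => Sum.elim (fun i => Z₁ (M.D₁ i) ω) (fun j => Z₂ (M.D₂ j) ω))
      = ((P.map fun ω => (fun i => Z₁ (M.D₁ i) ω, fun j => δ (M.D₂ j) ω)).map
          fun q => Sum.elim q.1 q.2).map fun x => 0 + M.mixing ρ *ᵥ x := by
        rw [AEMeasurable.map_map_of_aemeasurable hjoin.aemeasurable (hZ₁.prodMk hδ),
          AEMeasurable.map_map_of_aemeasurable hmixing.aemeasurable
            (hjoin.comp_aemeasurable (hZ₁.prodMk hδ))]
        simp only [Function.comp_def, zero_add, h.obs_eq_mixing_mulVec]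
    _ = multivariateNormal (M.H ρ *ᵥ Sum.elim β₁ β₂) (M.V θ₁ θ₂ ρ s₁ s₂) := by
        rw [(indepFun_iff_map_prod_eq_prod_map_map hZ₁ hδ).1 hindep,
          h.map_level₁_eq_multivariateNormal hR₁ hs₁,
          h.map_discrepancy_eq_multivariateNormal hR₂ hs₂,
          map_sumElim_prod_multivariateNormal _ _ (hR₁.smul hs₁).det_pos (hR₂.smul hs₂).det_pos,
          map_affine_multivariateNormal _ _ (by simp [det_mixing]), zero_add,
          H_mulVec_eq_mixing_mulVec, V_eq_mixing_mul]

end IsAutoregressive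

section Posterior

/-- The normal-inverse-gamma density of `(β₁, σ₁²)`, given by the one-level regression on
`F₁(D₁)`. -/
abbrev regressionPosterior₁ (θ₁ : Θ₁) (π₁ : LevelPrior (Fin p₁)) (z₁ : M.Q → ℝ) :
    (Fin p₁ → ℝ) × ℝ → ℝ :=
  π₁.posteriorDensity (M.F₁ M.D₁) (M.R₁ θ₁ M.D₁ M.D₁) (z₁ ∘ M.D₁)

/-- The normal-inverse-gamma density of `((ρ, β₂), σ₂²)`, given by the one-level regression on
`F = [z₁(D₂)  F₂(D₂)]`. -/
abbrev regressionPosterior₂ (θ₂ : Θ₂) (π₂ : LevelPrior (Unit ⊕ Fin p₂)) (z₁ z₂ : M.Q → ℝ) :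
    (Unit ⊕ Fin p₂ → ℝ) × ℝ → ℝ :=
  π₂.posteriorDensity (M.F z₁) (M.R₂ θ₂ M.D₂ M.D₂) (z₂ ∘ M.D₂)

variable {M} {θ₁ : Θ₁} {θ₂ : Θ₂} {π₁ : LevelPrior (Fin p₁)} {π₂ : LevelPrior (Unit ⊕ Fin p₂)}
  {z₁ z₂ : M.Q → ℝ}

lemma normalizesTo_joint₁
    (h₁ : π₁.IsRegular (M.F₁ M.D₁) (M.R₁ θ₁ M.D₁ M.D₁) (z₁ ∘ M.D₁)) :
    NormalizesTo volume (M.joint₁ θ₁ π₁ z₁) (M.regressionPosterior₁ θ₁ π₁ z₁) :=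
  h₁.normalizesTo_posteriorDensity

lemma joint_eq_mul (hR₁ : (M.R₁ θ₁ M.D₁ M.D₁).PosDef) (hR₂ : (M.R₂ θ₂ M.D₂ M.D₂).PosDef)
    (q : (Fin p₁ → ℝ) × (Unit ⊕ Fin p₂ → ℝ) × ℝ × ℝ) :
    M.joint θ₁ θ₂ π₁ π₂ z₁ z₂ q = M.joint₁ θ₁ π₁ z₁ (q.1, q.2.2.1) *
      (gaussianDensity (M.F z₁ *ᵥ q.2.1) (q.2.2.2 • M.R₂ θ₂ M.D₂ M.D₂) (z₂ ∘ M.D₂) *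
        (π₂.coefDensity q.2.2.2 q.2.1 * π₂.varDensity q.2.2.2)) := by
  obtain ⟨β₁, lam, s₁, s₂⟩ := q
  simp only [joint, joint₁]
  rcases le_or_gt s₁ 0 with hs₁ | hs₁
  · simp only [LevelPrior.varDensity_of_nonpos π₁ hs₁, mul_zero, zero_mul]
  rcases le_or_gt s₂ 0 with hs₂ | hs₂
  · simp only [LevelPrior.varDensity_of_nonpos π₂ hs₂, mul_zero]
  have hlam : lamVec (lam (Sum.inl ())) (lam ∘ Sum.inr) = lam := by
    ext (_ | _) <;> rfl
  rw [M.likelihood_eq_mul_gaussianDensity hR₁ hR₂ hs₁ hs₂, hlam, mul_mul_mul_comm]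

lemma normalizesTo_joint
    (h₁ : π₁.IsRegular (M.F₁ M.D₁) (M.R₁ θ₁ M.D₁ M.D₁) (z₁ ∘ M.D₁))
    (h₂ : π₂.IsRegular (M.F z₁) (M.R₂ θ₂ M.D₂ M.D₂) (z₂ ∘ M.D₂)) :
    NormalizesTo volume (M.joint θ₁ θ₂ π₁ π₂ z₁ z₂) (fun q =>
      M.regressionPosterior₁ θ₁ π₁ z₁ (q.1, q.2.2.1) *
        M.regressionPosterior₂ θ₂ π₂ z₁ z₂ (q.2.1, q.2.2.2)) := by
  rw [funext (joint_eq_mul h₁.posDef h₂.posDef)]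
  exact ((normalizesTo_joint₁ h₁).mul_prod h₂.normalizesTo_posteriorDensity).comp_measurePreserving
    (measurePreserving_prod_prod_prod_comm volume volume volume volume)

lemma post₁_eq (h₁ : π₁.IsRegular (M.F₁ M.D₁) (M.R₁ θ₁ M.D₁ M.D₁) (z₁ ∘ M.D₁))
    (β₁ : Fin p₁ → ℝ) (s₁ : ℝ) :
    M.post₁ θ₁ π₁ z₁ β₁ s₁ = M.regressionPosterior₁ θ₁ π₁ z₁ (β₁, s₁) :=
  (normalizesTo_joint₁ h₁).div_integral_eq (β₁, s₁)

lemma postVar₁_eq (h₁ : π₁.IsRegular (M.F₁ M.D₁) (M.R₁ θ₁ M.D₁ M.D₁) (z₁ ∘ M.D₁)) (s₁ : ℝ) :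
    M.postVar₁ θ₁ π₁ z₁ s₁ = invGammaDensity (π₁.postShape (Fin n₁))
      (π₁.postQ (M.F₁ M.D₁) (M.R₁ θ₁ M.D₁ M.D₁) (z₁ ∘ M.D₁) / 2) s₁ := by
  simp only [postVar₁, post₁_eq h₁]
  exact h₁.integral_posteriorDensity_coef s₁

lemma postCoef₁_eq (h₁ : π₁.IsRegular (M.F₁ M.D₁) (M.R₁ θ₁ M.D₁ M.D₁) (z₁ ∘ M.D₁))
    {s₁ : ℝ} (hs₁ : 0 < s₁) (β₁ : Fin p₁ → ℝ) :
    M.postCoef₁ θ₁ π₁ z₁ s₁ β₁ = gaussianDensity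
      (π₁.postCov (M.F₁ M.D₁) (M.R₁ θ₁ M.D₁ M.D₁) s₁ *ᵥ
        π₁.postVec (M.F₁ M.D₁) (M.R₁ θ₁ M.D₁ M.D₁) (z₁ ∘ M.D₁) s₁)
      (π₁.postCov (M.F₁ M.D₁) (M.R₁ θ₁ M.D₁ M.D₁) s₁) β₁ := by
  rw [postCoef₁, post₁_eq h₁, postVar₁_eq h₁]
  exact h₁.posteriorDensity_div_invGammaDensity β₁ hs₁

lemma postCoef₁_mul_postVar₁
    (h₁ : π₁.IsRegular (M.F₁ M.D₁) (M.R₁ θ₁ M.D₁ M.D₁) (z₁ ∘ M.D₁)) (β₁ : Fin p₁ → ℝ) (s₁ : ℝ) :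
    M.postCoef₁ θ₁ π₁ z₁ s₁ β₁ * M.postVar₁ θ₁ π₁ z₁ s₁ =
      M.regressionPosterior₁ θ₁ π₁ z₁ (β₁, s₁) := by
  rw [postCoef₁, post₁_eq h₁, postVar₁_eq h₁]
  exact π₁.posteriorDensity_div_mul_invGammaDensity _ _ _ β₁ s₁

lemma post_eq_mul (h₁ : π₁.IsRegular (M.F₁ M.D₁) (M.R₁ θ₁ M.D₁ M.D₁) (z₁ ∘ M.D₁))
    (h₂ : π₂.IsRegular (M.F z₁) (M.R₂ θ₂ M.D₂ M.D₂) (z₂ ∘ M.D₂)) (β₁ : Fin p₁ → ℝ)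
    (lam : Unit ⊕ Fin p₂ → ℝ) (s₁ s₂ : ℝ) :
    M.post θ₁ θ₂ π₁ π₂ z₁ z₂ β₁ lam s₁ s₂ =
      M.regressionPosterior₁ θ₁ π₁ z₁ (β₁, s₁) * M.regressionPosterior₂ θ₂ π₂ z₁ z₂ (lam, s₂) :=
  (normalizesTo_joint h₁ h₂).div_integral_eq (β₁, lam, s₁, s₂)

lemma post₂_eq (h₁ : π₁.IsRegular (M.F₁ M.D₁) (M.R₁ θ₁ M.D₁ M.D₁) (z₁ ∘ M.D₁))
    (h₂ : π₂.IsRegular (M.F z₁) (M.R₂ θ₂ M.D₂ M.D₂) (z₂ ∘ M.D₂)) (lam : Unit ⊕ Fin p₂ → ℝ)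
    (s₂ : ℝ) :
    M.post₂ θ₁ θ₂ π₁ π₂ z₁ z₂ lam s₂ = M.regressionPosterior₂ θ₂ π₂ z₁ z₂ (lam, s₂) := by
  simp only [post₂, post_eq_mul h₁ h₂, integral_mul_const, (normalizesTo_joint₁ h₁).integral_eq_one,
    one_mul]

lemma postVar₂_eq (h₁ : π₁.IsRegular (M.F₁ M.D₁) (M.R₁ θ₁ M.D₁ M.D₁) (z₁ ∘ M.D₁))
    (h₂ : π₂.IsRegular (M.F z₁) (M.R₂ θ₂ M.D₂ M.D₂) (z₂ ∘ M.D₂)) (s₂ : ℝ) :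
    M.postVar₂ θ₁ θ₂ π₁ π₂ z₁ z₂ s₂ = invGammaDensity (π₂.postShape (Fin n₂))
      (π₂.postQ (M.F z₁) (M.R₂ θ₂ M.D₂ M.D₂) (z₂ ∘ M.D₂) / 2) s₂ := by
  simp only [postVar₂, post₂_eq h₁ h₂]
  exact h₂.integral_posteriorDensity_coef s₂

lemma postCoef₂_eq (h₁ : π₁.IsRegular (M.F₁ M.D₁) (M.R₁ θ₁ M.D₁ M.D₁) (z₁ ∘ M.D₁))
    (h₂ : π₂.IsRegular (M.F z₁) (M.R₂ θ₂ M.D₂ M.D₂) (z₂ ∘ M.D₂)) {s₂ : ℝ} (hs₂ : 0 < s₂)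
    (lam : Unit ⊕ Fin p₂ → ℝ) :
    M.postCoef₂ θ₁ θ₂ π₁ π₂ z₁ z₂ s₂ lam = gaussianDensity
      (π₂.postCov (M.F z₁) (M.R₂ θ₂ M.D₂ M.D₂) s₂ *ᵥ
        π₂.postVec (M.F z₁) (M.R₂ θ₂ M.D₂ M.D₂) (z₂ ∘ M.D₂) s₂)
      (π₂.postCov (M.F z₁) (M.R₂ θ₂ M.D₂ M.D₂) s₂) lam := by
  rw [postCoef₂, post₂_eq h₁ h₂, postVar₂_eq h₁ h₂]
  exact h₂.posteriorDensity_div_invGammaDensity lam hs₂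

lemma postCoef₂_mul_postVar₂
    (h₁ : π₁.IsRegular (M.F₁ M.D₁) (M.R₁ θ₁ M.D₁ M.D₁) (z₁ ∘ M.D₁))
    (h₂ : π₂.IsRegular (M.F z₁) (M.R₂ θ₂ M.D₂ M.D₂) (z₂ ∘ M.D₂)) (lam : Unit ⊕ Fin p₂ → ℝ)
    (s₂ : ℝ) :
    M.postCoef₂ θ₁ θ₂ π₁ π₂ z₁ z₂ s₂ lam * M.postVar₂ θ₁ θ₂ π₁ π₂ z₁ z₂ s₂ =
      M.regressionPosterior₂ θ₂ π₂ z₁ z₂ (lam, s₂) := by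
  rw [postCoef₂, post₂_eq h₁ h₂, postVar₂_eq h₁ h₂]
  exact π₂.posteriorDensity_div_mul_invGammaDensity _ _ _ lam s₂

lemma post_eq_postCoef_mul_postVar
    (h₁ : π₁.IsRegular (M.F₁ M.D₁) (M.R₁ θ₁ M.D₁ M.D₁) (z₁ ∘ M.D₁))
    (h₂ : π₂.IsRegular (M.F z₁) (M.R₂ θ₂ M.D₂ M.D₂) (z₂ ∘ M.D₂)) (β₁ : Fin p₁ → ℝ)
    (lam : Unit ⊕ Fin p₂ → ℝ) (s₁ s₂ : ℝ) :
    M.post θ₁ θ₂ π₁ π₂ z₁ z₂ β₁ lam s₁ s₂ =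
      M.postCoef₁ θ₁ π₁ z₁ s₁ β₁ * M.postCoef₂ θ₁ θ₂ π₁ π₂ z₁ z₂ s₂ lam *
        M.postVar₁ θ₁ π₁ z₁ s₁ * M.postVar₂ θ₁ θ₂ π₁ π₂ z₁ z₂ s₂ := by
  rw [post_eq_mul h₁ h₂, ← postCoef₁_mul_postVar₁ h₁, ← postCoef₂_mul_postVar₂ h₁ h₂]
  ring

end Posterior

end TwoLevelModel

end

theorem mainTheorem7 {d n₁ n₂ p₁ p₂ : ℕ} {Θ₁ Θ₂ : Type*}
    (M : TwoLevelModel d n₁ n₂ p₁ p₂ Θ₁ Θ₂) (θ₁ : Θ₁) (θ₂ : Θ₂)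
    (π₁ : LevelPrior (Fin p₁)) (π₂ : LevelPrior (Unit ⊕ Fin p₂))
    (z₁ z₂ : M.Q → ℝ)
    (hR₁ : (M.R₁ θ₁ M.D₁ M.D₁).PosDef) (hR₂ : (M.R₂ θ₂ M.D₂ M.D₂).PosDef)
    (hπ₁ : π₁.Valid) (hπ₂ : π₂.Valid)
    -- the design matrices have full column rank
    (hF₁ : LinearIndependent ℝ (M.F₁ M.D₁).col) (hF : LinearIndependent ℝ (M.F z₁).col)
    -- with a non-informative prior, the data are not fitted exactly by the regression
    (hz₁ : π₁.IsJeffreys → ∀ β, M.F₁ M.D₁ *ᵥ β ≠ z₁ ∘ M.D₁)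
    (hz₂ : π₂.IsJeffreys → ∀ lam, M.F z₁ *ᵥ lam ≠ z₂ ∘ M.D₂) :
    -- the likelihoods are the densities of the observations in the autoregressive model
    (∀ (β₁ : Fin p₁ → ℝ) (β₂ : Fin p₂ → ℝ) (ρ s₁ s₂ : ℝ), 0 < s₁ → 0 < s₂ →
      ∀ (Ω : Type*) [MeasurableSpace Ω] (P : Measure Ω) [IsProbabilityMeasure P]
        (Z₁ Z₂ δ : M.Q → Ω → ℝ), M.IsAutoregressive θ₁ θ₂ β₁ β₂ ρ s₁ s₂ P Z₁ Z₂ δ →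
        P.map (fun ω i => Z₁ (M.D₁ i) ω) =
            volume.withDensity (fun y => ENNReal.ofReal (M.likelihood₁ θ₁ β₁ s₁ y)) ∧
          P.map (fun ω => Sum.elim (fun i => Z₁ (M.D₁ i) ω) (fun j => Z₂ (M.D₂ j) ω)) =
            volume.withDensity
              (fun y => ENNReal.ofReal (M.likelihood θ₁ θ₂ β₁ β₂ ρ s₁ s₂ y))) ∧
    -- the posteriors are well defined
    (Integrable (M.joint₁ θ₁ π₁ z₁) ∧ 0 < ∫ q, M.joint₁ θ₁ π₁ z₁ q) ∧
    (Integrable (M.joint θ₁ θ₂ π₁ π₂ z₁ z₂) ∧ 0 < ∫ q, M.joint θ₁ θ₂ π₁ π₂ z₁ z₂ q) ∧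
    -- the joint posterior factorises
    (∀ (β₁ : Fin p₁ → ℝ) (β₂ : Fin p₂ → ℝ) (ρ s₁ s₂ : ℝ),
      M.post θ₁ θ₂ π₁ π₂ z₁ z₂ β₁ (lamVec ρ β₂) s₁ s₂ =
        M.postCoef₁ θ₁ π₁ z₁ s₁ β₁ * M.postCoef₂ θ₁ θ₂ π₁ π₂ z₁ z₂ s₂ (lamVec ρ β₂) *
          M.postVar₁ θ₁ π₁ z₁ s₁ * M.postVar₂ θ₁ θ₂ π₁ π₂ z₁ z₂ s₂) ∧
    -- the factors are explicit
    (∀ (s₁ : ℝ) (β₁ : Fin p₁ → ℝ), 0 < s₁ →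
      M.postCoef₁ θ₁ π₁ z₁ s₁ β₁ =
        gaussianDensity
          (π₁.postCov (M.F₁ M.D₁) (M.R₁ θ₁ M.D₁ M.D₁) s₁ *ᵥ
            π₁.postVec (M.F₁ M.D₁) (M.R₁ θ₁ M.D₁ M.D₁) (z₁ ∘ M.D₁) s₁)
          (π₁.postCov (M.F₁ M.D₁) (M.R₁ θ₁ M.D₁ M.D₁) s₁) β₁) ∧
    (∀ (s₂ ρ : ℝ) (β₂ : Fin p₂ → ℝ), 0 < s₂ →
      M.postCoef₂ θ₁ θ₂ π₁ π₂ z₁ z₂ s₂ (lamVec ρ β₂) =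
        gaussianDensity
          (π₂.postCov (M.F z₁) (M.R₂ θ₂ M.D₂ M.D₂) s₂ *ᵥ
            π₂.postVec (M.F z₁) (M.R₂ θ₂ M.D₂ M.D₂) (z₂ ∘ M.D₂) s₂)
          (π₂.postCov (M.F z₁) (M.R₂ θ₂ M.D₂ M.D₂) s₂) (lamVec ρ β₂)) ∧
    (∀ s₁ : ℝ, M.postVar₁ θ₁ π₁ z₁ s₁ =
      invGammaDensity (π₁.postShape (Fin n₁))
        (π₁.postQ (M.F₁ M.D₁) (M.R₁ θ₁ M.D₁ M.D₁) (z₁ ∘ M.D₁) / 2) s₁) ∧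
    (∀ s₂ : ℝ, M.postVar₂ θ₁ θ₂ π₁ π₂ z₁ z₂ s₂ =
      invGammaDensity (π₂.postShape (Fin n₂))
        (π₂.postQ (M.F z₁) (M.R₂ θ₂ M.D₂ M.D₂) (z₂ ∘ M.D₂) / 2) s₂) := by
  have h₁ : π₁.IsRegular (M.F₁ M.D₁) (M.R₁ θ₁ M.D₁ M.D₁) (z₁ ∘ M.D₁) := ⟨hπ₁, hR₁, hF₁, hz₁⟩
  have h₂ : π₂.IsRegular (M.F z₁) (M.R₂ θ₂ M.D₂ M.D₂) (z₂ ∘ M.D₂) := ⟨hπ₂, hR₂, hF, hz₂⟩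
  have hjoint₁ := TwoLevelModel.normalizesTo_joint₁ h₁
  have hjoint := TwoLevelModel.normalizesTo_joint h₁ h₂
  refine ⟨fun β₁ β₂ ρ s₁ s₂ hs₁ hs₂ Ω _ P _ Z₁ Z₂ δ h => ⟨?_, ?_⟩,
    ⟨hjoint₁.integrable_left, hjoint₁.integral_left_pos⟩,
    ⟨hjoint.integrable_left, hjoint.integral_left_pos⟩,
    fun β₁ β₂ ρ s₁ s₂ => TwoLevelModel.post_eq_postCoef_mul_postVar h₁ h₂ β₁ (lamVec ρ β₂) s₁ s₂,
    fun s₁ β₁ hs₁ => TwoLevelModel.postCoef₁_eq h₁ hs₁ β₁,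
    fun s₂ ρ β₂ hs₂ => TwoLevelModel.postCoef₂_eq h₁ h₂ hs₂ (lamVec ρ β₂),
    TwoLevelModel.postVar₁_eq h₁, TwoLevelModel.postVar₂_eq h₁ h₂⟩
  · exact h.map_level₁_eq_multivariateNormal hR₁ hs₁
  · exact h.map_obs_eq_multivariateNormal hR₁ hR₂ hs₁ hs₂
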